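/- Let $(\mathcal X,Y)$ be a pair of random variables with values in $\mathcal E\times\mathbb R$, where $\mathcal E$ is a real Banach space endowed with a (measurable) semi-norm $\|\cdot\|$, and let $(\mathcal X_i,Y_i)_{i\ge1}$ be independent copies of $(\mathcal X,Y)$. Put $r(x)=\mathrm E(Y\mid\mathcal X=x)$, $\varepsilon=Y-r(\mathcal X)$, $\sigma_\varepsilon^2(x)=\mathrm E(\varepsilon^2\mid\mathcal X=x)<\infty$. Fix $\chi\in\mathcal E$ with $\sigma_\varepsilon^2(\chi)>0$ and let $F(t)=\mathrm P(\|\chi-\mathcal X\|\le t)$. Let $K:\mathbb R\to\mathbb R$ be a kernel, $(h_n)_{n\ge1}$ a sequence of positive bandwidths, and $$r_n^{[0]}(\chi)=\frac{\sum_{i=1}^nY_iK(\|\chi-\mathcal X_i\|/h_i)}{\sum_{i=1}^nK(\|\chi-\mathcal X_i\|/h_i)}.$$ Assume: (H1) $r$ and $\sigma_\varepsilon^2$ are continuous, with respect to the semi-norm, on a neighbourhood of $\chi$; $F(0)=0$; and (a version of) $\varphi(t)=\mathrm E[r(\mathcal X)-r(\chi)\mid\|\mathcal X-\chi\|=t]$,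 $t\ge0$, is differentiable at $t=0$. (H2) $K$ is nonnegative and bounded, vanishes outside $[0,1]$, $\inf_{[0,1]}K>0$, and $K$ is absolutely continuous on $[0,1]$. (H3) For every $s\in[0,1]$, $F(hs)/F(h)\to\tau_0(s)<\infty$ as $h\to0^+$. (H4) $h_n\to0$, $nF(h_n)\to\infty$, $\frac1n\sum_{i=1}^n\frac{h_i}{h_n}\frac{F(h_i)}{F(h_n)}\to\alpha_{[0]}<\infty$, and for every real $q\le2$, $\frac1n\sum_{i=1}^n\bigl[\frac{F(h_i)}{F(h_n)}\bigr]^q\to\beta_{[q]}<\infty$. (H5) There are $\lambda,\mu>0$ with $\mathrm E[\exp(\lambda|Y|^\mu)]<\infty$. (H7) For every $\delta>0$, $(\ln n)^\delta/\sqrt{nF(h_n)}\to0$. Assume moreover that $h_n\sqrt{nF(h_n)}\to0$ and $\ln n/(nF^2(h_n))\to0$. Put $$M_1=K(1)-\int_0^1K'(s)\tau_0(s)\,ds,\qquad M_2=K^2(1)-\int_0^1(K^2)'(s)\tau_0(s)\,ds,$$ $$\widehat F(t)=\frac1n\sum_{i=1}^n\mathbf 1_{\{\|\mathcal X_i-\chi\|\le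 t\}},\qquad\widehat\beta_{[1]}=\frac1n\sum_{i=1}^n\frac{\widehat F(h_i)}{\widehat F(h_n)}.$$ Then for any sequences of random variables $\widehat M_1,\widehat M_2,\widehat\sigma_\varepsilon(\chi)$ (indexed by $n$) that converge in probability to $M_1$, $M_2$ and $\sigma_\varepsilon(\chi)=\sqrt{\sigma_\varepsilon^2(\chi)}$ respectively, $$\sqrt{n\widehat F(h_n)}\sqrt{\frac{\widehat\beta_{[1]}\widehat M_1^2}{\widehat M_2\,\widehat\sigma_\varepsilon^2(\chi)}}\left(r_n^{[0]}(\chi)-r(\chi)\right)\xrightarrow{\ \mathcal D\ }\mathcal N(0,1)\qquad(n\to\infty),$$ where a quotient with denominator $0$ and the square root of a negative number are given the value $0$. -/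

import Mathlib

open MeasureTheory ProbabilityTheory Filter Topology

noncomputable section

namespace FunctionalRegression

/-! ### The model: covariate in a space with a semi-norm, regression function, sample -/

/-- The distribution function `F(t) = P(‖χ - 𝒳‖ ≤ t)` of the distance between the covariate `X`
and the fixed point `χ`, measured with the semi-norm `p`. -/
def smallBall {Ω E : Type*} [MeasurableSpace Ω] [AddCommGroup E] [Module ℝ E]
    (P : Measure Ω) (p : Seminorm ℝ E) (X : Ω → E) (χ : E) (t : ℝ) : ℝ :=
  P.real {ω | p (χ - X ω) ≤ t}

/-- The regression model `Y = r(𝒳) + ε` with `E(ε | 𝒳) = 0` and `E(ε² | 𝒳) = σ²(𝒳) < ∞`: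
`r` is the regression function `r(x) = E(Y | 𝒳 = x)` and `sigmaSq` is the conditional variance
function `σ_ε²(x) = E((Y - r(𝒳))² | 𝒳 = x)`. -/
structure IsRegressionModel {Ω E : Type*} [mΩ : MeasurableSpace Ω] [mE : MeasurableSpace E]
    (P : Measure Ω) (X : Ω → E) (Y : Ω → ℝ) (r sigmaSq : E → ℝ) : Prop where
  measurable_X : Measurable X
  measurable_Y : Measurable Y
  measurable_r : Measurable r
  measurable_sigmaSq : Measurable sigmaSq
  integrable_Y : Integrable Y P
  integrable_sq : Integrable (fun ω => (Y ω - r (X ω)) ^ 2) P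
  condExp_Y : P[Y | mE.comap X] =ᵐ[P] fun ω => r (X ω)
  condExp_sq : P[fun ω => (Y ω - r (X ω)) ^ 2 | mE.comap X] =ᵐ[P] fun ω => sigmaSq (X ω)

/-- `(Xs i, Ys i)`, `i = 1, 2, …`, are independent copies of the pair `(X, Y)`
(the index `0` is not used). -/
structure IsSample {Ω E : Type*} [MeasurableSpace Ω] [MeasurableSpace E]
    (P : Measure Ω) (X : Ω → E) (Y : Ω → ℝ) (Xs : ℕ → Ω → E) (Ys : ℕ → Ω → ℝ) : Prop where
  measurable_Xs : ∀ i, 1 ≤ i → Measurable (Xs i)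
  measurable_Ys : ∀ i, 1 ≤ i → Measurable (Ys i)
  indep : iIndepFun (fun (i : ℕ) (ω : Ω) => (Xs (i + 1) ω, Ys (i + 1) ω)) P
  identDistrib : ∀ i, 1 ≤ i →
    IdentDistrib (fun ω => (Xs i ω, Ys i ω)) (fun ω => (X ω, Y ω)) P P

/-! ### Estimators -/

/-- The recursive kernel estimator `r_n^{[ℓ]}(χ)`, for a distribution function `F`, a kernel `K`
and a sequence of bandwidths `h`. -/
def recEstimator {Ω E : Type*} [AddCommGroup E] [Module ℝ E]
    (p : Seminorm ℝ E) (χ : E) (F K : ℝ → ℝ) (h : ℕ → ℝ) (l : ℝ)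
    (Xs : ℕ → Ω → E) (Ys : ℕ → Ω → ℝ) (n : ℕ) (ω : Ω) : ℝ :=
  (∑ i ∈ Finset.Icc 1 n, Ys i ω / F (h i) ^ l * K (p (χ - Xs i ω) / h i)) /
    (∑ i ∈ Finset.Icc 1 n, 1 / F (h i) ^ l * K (p (χ - Xs i ω) / h i))

/-- The empirical distribution function `F̂(t) = (1/n) ∑_{i ≤ n} 1{‖𝒳_i - χ‖ ≤ t}` based on the
first `n` observations. -/
def empF {Ω E : Type*} [AddCommGroup E] [Module ℝ E] (p : Seminorm ℝ E) (χ : E)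
    (Xs : ℕ → Ω → E) (n : ℕ) (t : ℝ) (ω : Ω) : ℝ :=
  1 / (n : ℝ) * ∑ i ∈ Finset.Icc 1 n, {ω' : Ω | p (Xs i ω' - χ) ≤ t}.indicator (fun _ => (1 : ℝ)) ω

/-- The empirical counterpart `β̂_{[1]} = (1/n) ∑_{i ≤ n} F̂(h_i) / F̂(h_n)` of `β_{[1]}`, where `F̂`
is based on the first `n` observations. -/
def empBeta {Ω E : Type*} [AddCommGroup E] [Module ℝ E] (p : Seminorm ℝ E) (χ : E)
    (h : ℕ → ℝ) (Xs : ℕ → Ω → E) (n : ℕ) (ω : Ω) : ℝ :=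
  1 / (n : ℝ) * ∑ i ∈ Finset.Icc 1 n, empF p χ Xs n (h i) ω / empF p χ Xs n (h n) ω

/-- `M_1 = K(1) - ∫_0^1 K'(s) τ_0(s) ds`. -/
def M1 (K τ₀ : ℝ → ℝ) : ℝ := K 1 - ∫ s in (0 : ℝ)..1, deriv K s * τ₀ s

/-- `M_2 = K²(1) - ∫_0^1 (K²)'(s) τ_0(s) ds`. -/
def M2 (K τ₀ : ℝ → ℝ) : ℝ := K 1 ^ 2 - ∫ s in (0 : ℝ)..1, deriv (fun u => K u ^ 2) s * τ₀ s

/-- The studentized statistic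
`√(n F̂(h_n)) √(β̂_{[1]} M̂_1² / (M̂_2 σ̂_ε²(χ))) (r_n^{[0]}(χ) - r(χ))`, for given estimators
`M1hat`, `M2hat`, `sigmaHat` of `M_1`, `M_2`, `σ_ε(χ)`. -/
def studentized {Ω E : Type*} [AddCommGroup E] [Module ℝ E]
    (p : Seminorm ℝ E) (χ : E) (F K : ℝ → ℝ) (h : ℕ → ℝ) (r : E → ℝ)
    (Xs : ℕ → Ω → E) (Ys : ℕ → Ω → ℝ) (M1hat M2hat sigmaHat : ℕ → Ω → ℝ) (n : ℕ) (ω : Ω) : ℝ :=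
  √((n : ℝ) * empF p χ Xs n (h n) ω) *
    √(empBeta p χ h Xs n ω * M1hat n ω ^ 2 / (M2hat n ω * sigmaHat n ω ^ 2)) *
      (recEstimator p χ F K h 0 Xs Ys n ω - r χ)

/-! ### Assumptions -/

/-- `g` is continuous at every point of a neighbourhood of `χ`, all with respect to the
semi-norm `p`. -/
def ContinuousNear {E : Type*} [AddCommGroup E] [Module ℝ E]
    (p : Seminorm ℝ E) (g : E → ℝ) (χ : E) : Prop :=
  ∃ ρ > 0, ∀ x, p (x - χ) < ρ →
    ∀ ε > 0, ∃ η > 0, ∀ y, p (y - x) < η → |g y - g x| < ε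

/-- Assumptions on the model near `χ`. The function `φ(t) = E[r(𝒳) - r(χ) | ‖𝒳 - χ‖ = t]` is a version of the
conditional expectation, and its derivative at the end point `0` of `[0, ∞)` is one-sided. -/
structure H1 {Ω E : Type*} [MeasurableSpace Ω] [AddCommGroup E] [Module ℝ E]
    (P : Measure Ω) (p : Seminorm ℝ E) (X : Ω → E) (r sigmaSq : E → ℝ) (χ : E) : Prop where
  continuous_r : ContinuousNear p r χ
  continuous_sigmaSq : ContinuousNear p sigmaSq χ
  smallBall_zero : smallBall P p X χ 0 = 0
  differentiable_phi : ∃ φ : ℝ → ℝ, Measurable φ ∧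
    (P[fun ω => r (X ω) - r χ |
        MeasurableSpace.comap (fun ω => p (X ω - χ)) (borel ℝ)] =ᵐ[P] fun ω => φ (p (X ω - χ))) ∧
    DifferentiableWithinAt ℝ φ (Set.Ici 0) 0

/-- Assumptions on the kernel, with the regularity of `K` on `[0,1]` that gives a meaning to `K'` in
`M_1` and `M_2`. -/
structure H2 (K : ℝ → ℝ) : Prop where
  nonneg : ∀ t, 0 ≤ K t
  bounded : ∃ C, ∀ t, K t ≤ C
  support : ∀ t, t ∉ Set.Icc (0 : ℝ) 1 → K t = 0
  inf_pos : ∃ c > 0, ∀ t ∈ Set.Icc (0 : ℝ) 1, c ≤ K t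
  absolutelyContinuous : AbsolutelyContinuousOnInterval K 0 1

/-- The small ball probabilities are regular: `F(us)/F(u) → τ₀(s)` as `u → 0⁺`. -/
def H3 (F τ₀ : ℝ → ℝ) : Prop :=
  ∀ s ∈ Set.Icc (0 : ℝ) 1, Tendsto (fun u => F (u * s) / F u) (𝓝[>] 0) (𝓝 (τ₀ s))

/-- Assumptions on the bandwidths, with limits `α = α_{[ℓ]}` and `β r = β_{[r]}`, `r ≤ 2`. -/
structure H4 (F : ℝ → ℝ) (h : ℕ → ℝ) (l α : ℝ) (β : ℝ → ℝ) : Prop where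
  tendsto_h : Tendsto h atTop (𝓝 0)
  tendsto_nF : Tendsto (fun n : ℕ => (n : ℝ) * F (h n)) atTop atTop
  tendsto_A : Tendsto (fun n : ℕ =>
    1 / (n : ℝ) * ∑ i ∈ Finset.Icc 1 n, h i / h n * (F (h i) / F (h n)) ^ (1 - l)) atTop (𝓝 α)
  tendsto_B : ∀ r : ℝ, r ≤ 2 → Tendsto (fun n : ℕ =>
    1 / (n : ℝ) * ∑ i ∈ Finset.Icc 1 n, (F (h i) / F (h n)) ^ r) atTop (𝓝 (β r))

/-- Exponential moment: `E exp(λ|Y|^μ) < ∞` for some `λ, μ > 0`. -/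
def H5 {Ω : Type*} [MeasurableSpace Ω] (P : Measure Ω) (Y : Ω → ℝ) : Prop :=
  ∃ lam > 0, ∃ μ > 0, Integrable (fun ω => Real.exp (lam * |Y ω| ^ (μ : ℝ))) P

/-- `(ln n)^δ / √(n F(h_n)) → 0` for every `δ > 0`. -/
def H7 (F : ℝ → ℝ) (h : ℕ → ℝ) : Prop :=
  ∀ δ : ℝ, 0 < δ →
    Tendsto (fun n : ℕ => Real.log n ^ δ / √((n : ℝ) * F (h n))) atTop (𝓝 0)

end FunctionalRegression

end

/-!
Write `D_i = ‖χ - 𝒳_i‖`, `Δ_i = K(D_i / h_i)` and `N_n = n F(h_n)`. Then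
`r_n(χ) - r(χ) = ∑ (Y_i - r(χ)) Δ_i / ∑ Δ_i`, and everything is measured at the scale `N_n → ∞`.

*Population moments.* Since `K` is absolutely continuous on `[0,1]`, `K(D/u)` is an integral of
indicators `1{D ≤ u s}` against `K'`; Fubini and dominated convergence give
`E K(D/u) / F(u) → M₁`, and likewise `E K²(D/u) / F(u) → M₂` (`tendsto_integral_kernel_div`). A
factor that is continuous at `χ` only contributes its value there
(`tendsto_integral_mul_kernel_div`), so `E[ε² K²(D/u)] ∼ σ²(χ) M₂ F(u)`. Sums over the bandwidths
follow by Toeplitz' lemma with the weights `F(h_i)` (`H4.tendsto_sum_div`): if `G(u) ∼ M F(u)` then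
`∑_{i ≤ n} G(h_i) ∼ β_{[1]} M N_n`. That `β_{[1]} > 0` comes from Cauchy–Schwarz and the
convergence of the averages with exponent `-1`.

*Numerator.* Split `Y_i - r(χ) = ε_i + (r(𝒳_i) - r(χ))`. The errors have variance
`∼ V N_n` with `V = β_{[1]} σ²(χ) M₂`, and Lindeberg's theorem applies
(`tendstoInDistribution_sum_of_lindeberg`, proved by comparing characteristic functions): the
exponential moment of `Y` makes `n E[Y²; |Y| > κ √N_n]` vanish because `√N_n` outgrows every power
of `ln n`. In the second part the variance is `o(N_n)`, while the mean is of order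
`∑ h_i F(h_i) ∼ α h_n N_n = o(√N_n)`; this uses `φ(0) = 0`, which is forced by the continuity of `r`
at `χ` (`exists_integral_bias_le`).

*Denominator and studentization.* Second moments give `∑ Δ_i / N_n → β_{[1]} M₁`,
`F̂(h_n) / F(h_n) → 1` and `β̂_{[1]} → β_{[1]}` in probability. The studentized statistic is the
normalised numerator times a factor tending to `1` in probability, outside an event of vanishing
probability on which all `Δ_i` vanish (`studentized_eq_mul`); Slutsky's theorem concludes.
-/

namespace FunctionalRegression

/-! ### Lindeberg's central limit theorem -/

open Complex in
/-- The second order Taylor remainder of `x ↦ exp (i x)` is `O(|x|³)` for small `x` and `O(x²)` for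
large `x`; with a common constant both bounds hold everywhere. -/
lemma norm_exp_I_mul_sub_taylor_le (x : ℝ) :
    ‖cexp (x * I) - (1 + x * I - x ^ 2 / 2)‖ ≤ 4 * |x| ^ 3 ∧
      ‖cexp (x * I) - (1 + x * I - x ^ 2 / 2)‖ ≤ 4 * x ^ 2 := by
  have hx2 : |x| ^ 2 = x ^ 2 := sq_abs x
  have hx0 := abs_nonneg x
  rcases le_total |x| 1 with hx | hx
  · have h := Complex.exp_bound (x := x * I) (by simpa using hx) (n := 3) (by norm_num)
    have e : ∑ m ∈ Finset.range 3, ((x : ℂ) * I) ^ m / (m.factorial : ℂ) =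
        1 + x * I - x ^ 2 / 2 := by
      simp [Finset.sum_range_succ, mul_pow, Nat.factorial]
      ring
    rw [e] at h
    have h3 : ‖cexp (x * I) - (1 + x * I - x ^ 2 / 2)‖ ≤ |x| ^ 3 := by
      refine h.trans ?_
      simp only [norm_mul, norm_real, Real.norm_eq_abs, norm_I, mul_one]
      norm_num [Nat.factorial]
      nlinarith [pow_nonneg hx0 3]
    constructor
    · nlinarith [pow_nonneg hx0 3]
    · rw [← hx2]
      nlinarith [pow_nonneg hx0 2, pow_nonneg hx0 3]
  · have h : ‖cexp (x * I) - (1 + x * I - x ^ 2 / 2)‖ ≤ 1 + (1 + |x| + |x| ^ 2 / 2) := by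
      refine (norm_sub_le _ _).trans (add_le_add (by simp [norm_exp_ofReal_mul_I]) ?_)
      refine (norm_sub_le _ _).trans (add_le_add ((norm_add_le _ _).trans (by simp)) ?_)
      simp
    constructor
    · nlinarith [pow_nonneg hx0 3, mul_nonneg hx0 (sub_nonneg.2 hx), pow_nonneg hx0 2]
    · rw [← hx2]
      nlinarith [pow_nonneg hx0 2]

lemma abs_exp_neg_sub_le {y : ℝ} (hy : 0 ≤ y) : |Real.exp (-y) - (1 - y)| ≤ y ^ 2 := by
  rcases le_total y 1 with h | h
  · have := Real.norm_exp_sub_one_sub_id_le (x := -y) (by simpa [abs_of_nonneg hy] using h)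
    rw [Real.norm_eq_abs, Real.norm_eq_abs, sq_abs] at this
    rw [show Real.exp (-y) - (1 - y) = Real.exp (-y) - 1 - -y by ring]
    simpa using this
  · have h1 := Real.add_one_le_exp (-y)
    have h2 : Real.exp (-y) ≤ 1 := Real.exp_le_one_iff.2 (by linarith)
    rw [abs_of_nonneg (by linarith)]
    nlinarith

lemma norm_prod_sub_prod_le {ι : Type*} (s : Finset ι) {a b : ι → ℂ} (ha : ∀ i ∈ s, ‖a i‖ ≤ 1)
    (hb : ∀ i ∈ s, ‖b i‖ ≤ 1) : ‖∏ i ∈ s, a i - ∏ i ∈ s, b i‖ ≤ ∑ i ∈ s, ‖a i - b i‖ := by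
  classical
  induction s using Finset.induction_on with
  | empty => simp
  | insert j s hj ih =>
    rw [Finset.prod_insert hj, Finset.prod_insert hj, Finset.sum_insert hj]
    have e : a j * ∏ i ∈ s, a i - b j * ∏ i ∈ s, b i =
        (a j - b j) * ∏ i ∈ s, a i + b j * (∏ i ∈ s, a i - ∏ i ∈ s, b i) := by ring
    rw [e]
    refine (norm_add_le _ _).trans (add_le_add ?_ ?_)
    · rw [norm_mul, norm_prod]
      exact mul_le_of_le_one_right (norm_nonneg _)
        (Finset.prod_le_one (fun _ _ => norm_nonneg _)
          fun i hi => ha i (Finset.mem_insert_of_mem hi))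
    · rw [norm_mul]
      exact (mul_le_of_le_one_left (norm_nonneg _) (hb j (Finset.mem_insert_self _ _))).trans
        (ih (fun i hi => ha i (Finset.mem_insert_of_mem hi))
          fun i hi => hb i (Finset.mem_insert_of_mem hi))

section Lindeberg
variable {Ω : Type*} [MeasurableSpace Ω] {P : Measure Ω} [IsProbabilityMeasure P]

open Complex in
/-- Second order expansion of the characteristic function of a centred square integrable
variable, with the remainder in Lindeberg's form. -/
lemma norm_charFun_sub_taylor_le {X : Ω → ℝ} (hX : MemLp X 2 P) (h0 : ∫ ω, X ω ∂P = 0)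
    {η : ℝ} (hη : 0 < η) (t : ℝ) :
    ‖charFun (P.map X) t - (1 - t ^ 2 * (∫ ω, X ω ^ 2 ∂P : ℝ) / 2 : ℝ)‖ ≤
      4 * |t| ^ 3 * η * ∫ ω, X ω ^ 2 ∂P +
        4 * t ^ 2 * ∫ ω, {ω | η < |X ω|}.indicator (fun ω => X ω ^ 2) ω ∂P := by
  have hXm := hX.aestronglyMeasurable.aemeasurable
  have hi1 : Integrable X P := hX.integrable (by norm_num)
  have hi2 : Integrable (fun ω => X ω ^ 2) P := hX.integrable_sq
  have hind : Integrable ({ω | η < |X ω|}.indicator (fun ω => X ω ^ 2)) P :=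
    hi2.indicator₀ (nullMeasurableSet_lt aemeasurable_const hXm.abs)
  rw [charFun_apply_real, integral_map hXm (by fun_prop)]
  have hlin : ∫ ω, ((1 : ℂ) + (t * X ω : ℝ) * I - ((t * X ω : ℝ) : ℂ) ^ 2 / 2) ∂P =
      ((1 - t ^ 2 * (∫ ω, X ω ^ 2 ∂P : ℝ) / 2 : ℝ) : ℂ) := by
    have e : (fun ω => (1 : ℂ) + (t * X ω : ℝ) * I - ((t * X ω : ℝ) : ℂ) ^ 2 / 2) =
        fun ω => (1 : ℂ) + (t * I) * (X ω : ℂ) - (t ^ 2 / 2 : ℂ) * ((X ω ^ 2 : ℝ) : ℂ) := by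
      ext ω; push_cast; ring
    rw [e, integral_sub, integral_add, integral_const_mul, integral_const_mul,
      integral_complex_ofReal, integral_complex_ofReal, h0]
    · simp; ring
    · simp
    · exact hi1.ofReal.const_mul _
    · exact (integrable_const _).add (hi1.ofReal.const_mul _)
    · exact hi2.ofReal.const_mul _
  have hlint : Integrable
      (fun ω => (1 : ℂ) + (t * X ω : ℝ) * I - ((t * X ω : ℝ) : ℂ) ^ 2 / 2) P := by
    have e : (fun ω => (1 : ℂ) + (t * X ω : ℝ) * I - ((t * X ω : ℝ) : ℂ) ^ 2 / 2) =
        fun ω => (1 : ℂ) + (t * I) * (X ω : ℂ) - (t ^ 2 / 2 : ℂ) * ((X ω ^ 2 : ℝ) : ℂ) := by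
      ext ω; push_cast; ring
    rw [e]
    exact ((integrable_const _).add (hi1.ofReal.const_mul _)).sub (hi2.ofReal.const_mul _)
  have hexp : Integrable (fun ω => cexp (t * X ω * I)) P := by
    refine Integrable.of_bound (C := 1) (by fun_prop) (ae_of_all _ fun ω => ?_)
    rw [← ofReal_mul, norm_exp_ofReal_mul_I]
  rw [← hlin, ← integral_sub hexp hlint, ← integral_const_mul, ← integral_const_mul,
    ← integral_add (hi2.const_mul _) (hind.const_mul _)]
  refine norm_integral_le_of_norm_le ((hi2.const_mul _).add (hind.const_mul _))
    (ae_of_all _ fun ω => ?_)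
  have h := norm_exp_I_mul_sub_taylor_le (t * X ω)
  rw [← ofReal_mul]
  by_cases hω : η < |X ω|
  · have : {ω | η < |X ω|}.indicator (fun ω => X ω ^ 2) ω = X ω ^ 2 :=
      by simp [hω]
    rw [this]
    refine h.2.trans ?_
    have : 0 ≤ 4 * |t| ^ 3 * η * X ω ^ 2 := by positivity
    linarith [mul_pow t (X ω) 2]
  · have : {ω | η < |X ω|}.indicator (fun ω => X ω ^ 2) ω = 0 :=
      by simp [hω]
    rw [this]
    refine h.1.trans ?_
    rw [abs_mul, mul_pow, pow_succ |X ω|, sq_abs]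
    have := mul_le_mul_of_nonneg_left (not_lt.1 hω) (by positivity : 0 ≤ 4 * |t| ^ 3 * X ω ^ 2)
    linarith

/-- The characteristic function of a row sum is compared, factor by factor, with a product of
Gaussian characteristic functions that have the same variances. -/
lemma tendsto_charFun_sum_of_lindeberg {ι : Type*} {s : ℕ → Finset ι} {X : ℕ → ι → Ω → ℝ}
    (hX : ∀ n, ∀ i, MemLp (X n i) 2 P) (hind : ∀ n, iIndepFun (X n) P)
    (h0 : ∀ n i, ∫ ω, X n i ω ∂P = 0)
    (hvar : Tendsto (fun n => ∑ i ∈ s n, ∫ ω, X n i ω ^ 2 ∂P) atTop (𝓝 1))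
    (hL : ∀ η > 0, Tendsto (fun n => ∑ i ∈ s n,
      ∫ ω, {ω | η < |X n i ω|}.indicator (fun ω => X n i ω ^ 2) ω ∂P) atTop (𝓝 0)) (t : ℝ) :
    Tendsto (fun n => charFun (P.map fun ω => ∑ i ∈ s n, X n i ω) t) atTop
      (𝓝 (Complex.exp (-t ^ 2 / 2))) := by
  set V : ℕ → ι → ℝ := fun n i => ∫ ω, X n i ω ^ 2 ∂P with hV
  set S : ℕ → ℝ := fun n => ∑ i ∈ s n, V n i with hS
  set Λ : ℝ → ℕ → ℝ := fun η n => ∑ i ∈ s n,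
    ∫ ω, {ω | η < |X n i ω|}.indicator (fun ω => X n i ω ^ 2) ω ∂P with hΛ
  have hm : ∀ n i, AEMeasurable (X n i) P := fun n i => (hX n i).aestronglyMeasurable.aemeasurable
  have hV0 : ∀ n i, 0 ≤ V n i := fun n i => integral_nonneg fun _ => sq_nonneg _
  have hnn : ∀ η n i, 0 ≤ ∫ ω, {ω | η < |X n i ω|}.indicator (fun ω => X n i ω ^ 2) ω ∂P :=
    fun η n i => integral_nonneg fun _ => Set.indicator_nonneg (fun _ _ => sq_nonneg _) _
  -- every single variance is small, by truncation at `η`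
  have hVle : ∀ η > 0, ∀ n, ∀ i ∈ s n, V n i ≤ η ^ 2 + Λ η n := by
    intro η hη n i hi
    have h1 : V n i ≤ η ^ 2 +
        ∫ ω, {ω | η < |X n i ω|}.indicator (fun ω => X n i ω ^ 2) ω ∂P := by
      have hi2 : Integrable (fun ω => X n i ω ^ 2) P := (hX n i).integrable_sq
      have hiI : Integrable ({ω | η < |X n i ω|}.indicator (fun ω => X n i ω ^ 2)) P :=
        hi2.indicator₀ (nullMeasurableSet_lt aemeasurable_const (hm n i).abs)
      have : ∫ ω, (η ^ 2 + {ω | η < |X n i ω|}.indicator (fun ω => X n i ω ^ 2) ω) ∂P =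
          η ^ 2 + ∫ ω, {ω | η < |X n i ω|}.indicator (fun ω => X n i ω ^ 2) ω ∂P := by
        rw [integral_add (integrable_const _) hiI]; simp
      rw [← this]
      refine integral_mono hi2 ((integrable_const _).add hiI) fun ω => ?_
      by_cases hω : η < |X n i ω|
      · have : {ω | η < |X n i ω|}.indicator (fun ω => X n i ω ^ 2) ω = X n i ω ^ 2 :=
          by simp [hω]
        simp only [this]
        nlinarith
      · have : {ω | η < |X n i ω|}.indicator (fun ω => X n i ω ^ 2) ω = 0 :=
          by simp [hω]
        simp only [this, add_zero]
        rw [← sq_abs (X n i ω)]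
        exact pow_le_pow_left₀ (abs_nonneg _) (not_lt.1 hω) 2
    have h2 := Finset.single_le_sum
      (f := fun i => ∫ ω, {ω | η < |X n i ω|}.indicator (fun ω => X n i ω ^ 2) ω ∂P)
      (fun i _ => hnn η n i) hi
    simp only [hΛ]
    linarith
  have hbound : ∀ η > 0, ∀ n,
      ‖charFun (P.map fun ω => ∑ i ∈ s n, X n i ω) t - Complex.exp (-(t ^ 2 * S n / 2) : ℝ)‖ ≤
        4 * |t| ^ 3 * η * S n + 4 * t ^ 2 * Λ η n + t ^ 4 / 4 * (η ^ 2 + Λ η n) * S n := by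
    intro η hη n
    have e1 : charFun (P.map fun ω => ∑ i ∈ s n, X n i ω) t =
        ∏ i ∈ s n, charFun (P.map (X n i)) t := by
      rw [((hind n).restrict _).charFun_map_fun_finsetSum_eq_prod (fun i _ => hm n i)]
      simp
    have e2 : Complex.exp (-(t ^ 2 * S n / 2) : ℝ) =
        ∏ i ∈ s n, Complex.exp (-(t ^ 2 * V n i / 2) : ℝ) := by
      rw [← Complex.exp_sum, ← Complex.ofReal_sum]
      simp only [hS, Finset.mul_sum, Finset.sum_div, Finset.sum_neg_distrib]
    rw [e1, e2]
    have hpm : ∀ i, IsProbabilityMeasure (P.map (X n i)) :=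
      fun i => Measure.isProbabilityMeasure_map (hm n i)
    refine (norm_prod_sub_prod_le _ (fun i _ => norm_charFun_le_one _) fun i _ => ?_).trans ?_
    · rw [Complex.norm_exp]
      have := mul_nonneg (sq_nonneg t) (hV0 n i)
      refine Real.exp_le_one_iff.2 ?_
      rw [Complex.ofReal_re]
      linarith
    have hterm : ∀ i ∈ s n,
        ‖charFun (P.map (X n i)) t - Complex.exp (-(t ^ 2 * V n i / 2) : ℝ)‖ ≤
        4 * |t| ^ 3 * η * V n i + 4 * t ^ 2 *
          (∫ ω, {ω | η < |X n i ω|}.indicator (fun ω => X n i ω ^ 2) ω ∂P) +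
          t ^ 4 / 4 * (η ^ 2 + Λ η n) * V n i := by
      intro i hi
      have h1 := norm_charFun_sub_taylor_le (hX n i) (h0 n i) hη t
      have hy : 0 ≤ t ^ 2 * V n i / 2 := by
        have := mul_nonneg (sq_nonneg t) (hV0 n i)
        linarith
      have h2 : ‖((1 - t ^ 2 * V n i / 2 : ℝ) : ℂ) - Complex.exp (-(t ^ 2 * V n i / 2) : ℝ)‖ ≤
          t ^ 4 / 4 * (η ^ 2 + Λ η n) * V n i := by
        rw [← Complex.ofReal_exp, ← Complex.ofReal_sub, Complex.norm_real, norm_sub_rev,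
          Real.norm_eq_abs]
        refine (abs_exp_neg_sub_le hy).trans ?_
        have := mul_le_mul_of_nonneg_right (hVle η hη n i hi) (hV0 n i)
        have := mul_le_mul_of_nonneg_left this (by positivity : 0 ≤ t ^ 4 / 4)
        nlinarith
      refine (norm_sub_le_norm_sub_add_norm_sub _ ((1 - t ^ 2 * V n i / 2 : ℝ) : ℂ) _).trans ?_
      exact add_le_add h1 h2
    refine (Finset.sum_le_sum hterm).trans (le_of_eq ?_)
    simp only [Finset.sum_add_distrib, ← Finset.mul_sum, hS, hΛ]
  have hdiff : Tendsto (fun n => charFun (P.map fun ω => ∑ i ∈ s n, X n i ω) t -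
      Complex.exp (-(t ^ 2 * S n / 2) : ℝ)) atTop (𝓝 0) := by
    rw [Metric.tendsto_nhds]
    intro ε hε
    obtain ⟨η, hηε, hη⟩ : ∃ η : ℝ, 4 * |t| ^ 3 * η + t ^ 4 / 4 * η ^ 2 < ε ∧ 0 < η := by
      have hc : Tendsto (fun η : ℝ => 4 * |t| ^ 3 * η + t ^ 4 / 4 * η ^ 2) (𝓝[>] 0) (𝓝 0) := by
        have : Continuous (fun η : ℝ => 4 * |t| ^ 3 * η + t ^ 4 / 4 * η ^ 2) := by fun_prop
        simpa using (this.tendsto 0).mono_left nhdsWithin_le_nhds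
      exact ((hc.eventually (gt_mem_nhds hε)).and self_mem_nhdsWithin).exists
    have hlim : Tendsto (fun n => 4 * |t| ^ 3 * η * S n + 4 * t ^ 2 * Λ η n +
        t ^ 4 / 4 * (η ^ 2 + Λ η n) * S n) atTop
        (𝓝 (4 * |t| ^ 3 * η * 1 + 4 * t ^ 2 * 0 + t ^ 4 / 4 * (η ^ 2 + 0) * 1)) :=
      ((hvar.const_mul _).add ((hL η hη).const_mul _)).add
        ((((hL η hη).const_add _).const_mul _).mul hvar)
    have hlt : 4 * |t| ^ 3 * η * 1 + 4 * t ^ 2 * 0 + t ^ 4 / 4 * (η ^ 2 + 0) * 1 < ε := by linarith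
    filter_upwards [hlim.eventually (gt_mem_nhds hlt)] with n hn
    rw [dist_zero_right]
    exact (hbound η hη n).trans_lt hn
  have hexp : Tendsto (fun n => Complex.exp (-(t ^ 2 * S n / 2) : ℝ)) atTop
      (𝓝 (Complex.exp (-(t ^ 2 * 1 / 2) : ℝ))) :=
    (Complex.continuous_exp.tendsto _).comp
      ((Complex.continuous_ofReal.tendsto _).comp (((hvar.const_mul _).div_const _).neg))
  have := hdiff.add hexp
  simp only [sub_add_cancel, zero_add] at this
  convert this using 2
  push_cast
  ring_nf

/-- **Lindeberg's central limit theorem** for triangular arrays that are independent in each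
row. -/
theorem tendstoInDistribution_sum_of_lindeberg {ι : Type*} {s : ℕ → Finset ι}
    {X : ℕ → ι → Ω → ℝ}
    (hX : ∀ n, ∀ i, MemLp (X n i) 2 P) (hind : ∀ n, iIndepFun (X n) P)
    (h0 : ∀ n i, ∫ ω, X n i ω ∂P = 0)
    (hvar : Tendsto (fun n => ∑ i ∈ s n, ∫ ω, X n i ω ^ 2 ∂P) atTop (𝓝 1))
    (hL : ∀ η > 0, Tendsto (fun n => ∑ i ∈ s n,
      ∫ ω, {ω | η < |X n i ω|}.indicator (fun ω => X n i ω ^ 2) ω ∂P) atTop (𝓝 0)) :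
    TendstoInDistribution (fun n ω => ∑ i ∈ s n, X n i ω) atTop (id : ℝ → ℝ) (fun _ => P)
      (gaussianReal 0 1) where
  forall_aemeasurable n := Finset.aemeasurable_fun_sum _ fun i _ =>
    (hX n i).aestronglyMeasurable.aemeasurable
  tendsto := by
    refine ProbabilityMeasure.tendsto_iff_tendsto_charFun.2 fun t => ?_
    simpa [charFun_gaussianReal, neg_div] using
      tendsto_charFun_sum_of_lindeberg hX hind h0 hvar hL t

end Lindeberg

/-! ### Convergence in probability -/

section InMeasure
variable {Ω : Type*} [MeasurableSpace Ω] {P : Measure Ω}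

/-- Continuous mapping theorem for convergence in probability to a constant. -/
lemma tendstoInMeasure_comp_of_continuousAt {ι S T : Type*} [PseudoMetricSpace S]
    [PseudoMetricSpace T] {l : Filter ι} {f : ι → Ω → S} {c : S}
    (hf : TendstoInMeasure P f l fun _ => c) {g : S → T} (hg : ContinuousAt g c) :
    TendstoInMeasure P (fun n ω => g (f n ω)) l fun _ => g c := by
  rw [tendstoInMeasure_iff_dist] at hf ⊢
  intro ε hε
  obtain ⟨δ, hδ, h⟩ := Metric.continuousAt_iff.1 hg ε hε
  refine tendsto_of_tendsto_of_tendsto_of_le_of_le tendsto_const_nhds (hf δ hδ)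
    (fun _ => zero_le) fun n => measure_mono fun ω hω => ?_
  by_contra hlt
  exact absurd (h (not_le.1 hlt)) (not_lt.2 hω)

/-- Continuous mapping theorem for two sequences that converge in probability to constants. -/
lemma tendstoInMeasure_comp₂_of_continuousAt {ι : Type*} {l : Filter ι} {f g : ι → Ω → ℝ}
    {c d : ℝ} (hf : TendstoInMeasure P f l fun _ => c) (hg : TendstoInMeasure P g l fun _ => d)
    {φ : ℝ × ℝ → ℝ} (hφ : ContinuousAt φ (c, d)) :
    TendstoInMeasure P (fun n ω => φ (f n ω, g n ω)) l fun _ => φ (c, d) := by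
  rw [tendstoInMeasure_iff_dist] at hf hg ⊢
  intro ε hε
  obtain ⟨δ, hδ, h⟩ := Metric.continuousAt_iff.1 hφ ε hε
  have hsum := (hf δ hδ).add (hg δ hδ)
  rw [add_zero] at hsum
  refine tendsto_of_tendsto_of_tendsto_of_le_of_le tendsto_const_nhds hsum
    (fun _ => zero_le) fun n => (measure_mono fun ω hω => ?_).trans (measure_union_le _ _)
  by_contra hlt
  simp only [Set.mem_union, Set.mem_ofPred_eq, not_or, not_le] at hlt hω
  exact absurd (h (x := (f n ω, g n ω)) (max_lt hlt.1 hlt.2)) (not_lt.2 hω)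

/-- Convergence in probability of row sums of an array with independent rows, from convergence of
the means and smallness of the second moments. -/
lemma tendstoInMeasure_sum_of_second_moment [IsProbabilityMeasure P] {ι : Type*}
    {s : ℕ → Finset ι} {X : ℕ → ι → Ω → ℝ}
    (hX : ∀ n i, MemLp (X n i) 2 P) (hind : ∀ n, iIndepFun (X n) P) {c : ℝ}
    (hmean : Tendsto (fun n => ∑ i ∈ s n, ∫ ω, X n i ω ∂P) atTop (𝓝 c))
    (hsq : Tendsto (fun n => ∑ i ∈ s n, ∫ ω, X n i ω ^ 2 ∂P) atTop (𝓝 0)) :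
    TendstoInMeasure P (fun n ω => ∑ i ∈ s n, X n i ω) atTop fun _ => c := by
  rw [tendstoInMeasure_iff_dist]
  intro ε hε
  have hε2 : 0 < ε / 2 := half_pos hε
  have hup : Tendsto (fun n => ENNReal.ofReal ((∑ i ∈ s n, ∫ ω, X n i ω ^ 2 ∂P) / (ε / 2) ^ 2))
      atTop (𝓝 0) := by
    have := ENNReal.tendsto_ofReal (hsq.div_const ((ε / 2) ^ 2))
    simpa using this
  refine tendsto_of_tendsto_of_tendsto_of_le_of_le' tendsto_const_nhds hup
    (Eventually.of_forall fun _ => zero_le) ?_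
  filter_upwards [Metric.tendsto_nhds.1 hmean _ hε2] with n hn
  have hmem : MemLp (∑ i ∈ s n, X n i) 2 P := memLp_finsetSum' _ fun i _ => hX n i
  have hexp : ∫ ω, (∑ i ∈ s n, X n i) ω ∂P = ∑ i ∈ s n, ∫ ω, X n i ω ∂P := by
    simp only [Finset.sum_apply]
    exact integral_finsetSum _ fun i _ => (hX n i).integrable (by norm_num)
  have hvar : Var[∑ i ∈ s n, X n i; P] ≤ ∑ i ∈ s n, ∫ ω, X n i ω ^ 2 ∂P := by
    rw [IndepFun.variance_sum (fun i _ => hX n i) fun i _ j _ hij => (hind n).indepFun hij]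
    exact Finset.sum_le_sum fun i _ => variance_le_expectation_sq (hX n i).aestronglyMeasurable
  calc P {ω | ε ≤ dist (∑ i ∈ s n, X n i ω) c}
      ≤ P {ω | ε / 2 ≤ |(∑ i ∈ s n, X n i) ω - ∫ ω, (∑ i ∈ s n, X n i) ω ∂P|} := by
        refine measure_mono fun ω hω => ?_
        rw [Set.mem_ofPred_eq] at hω ⊢
        rw [hexp, Finset.sum_apply]
        have := dist_triangle (∑ i ∈ s n, X n i ω) (∑ i ∈ s n, ∫ ω, X n i ω ∂P) c
        rw [← Real.dist_eq]
        linarith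
    _ ≤ ENNReal.ofReal (Var[∑ i ∈ s n, X n i; P] / (ε / 2) ^ 2) :=
        meas_ge_le_variance_div_sq hmem hε2
    _ ≤ _ := by gcongr

end InMeasure

/-! ### Weighted averages -/

section Toeplitz

/-- Toeplitz' lemma for weights `w i ≥ 0` with divergent normalisation `N n`. -/
lemma tendsto_sum_mul_div {w g N : ℕ → ℝ} {B L : ℝ} (hw : ∀ i, 0 ≤ w i)
    (hN : Tendsto N atTop atTop)
    (hB : Tendsto (fun n => (∑ i ∈ Finset.range n, w i) / N n) atTop (𝓝 B)) (hB0 : 0 < B)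
    (hg : Tendsto g atTop (𝓝 L)) :
    Tendsto (fun n => (∑ i ∈ Finset.range n, w i * g i) / N n) atTop (𝓝 (B * L)) := by
  have hW : Tendsto (fun n => ∑ i ∈ Finset.range n, w i) atTop atTop := by
    refine (hB.pos_mul_atTop hB0 hN).congr' ?_
    filter_upwards [hN.eventually_gt_atTop 0] with n hn
    field_simp
  have ho : (fun i => w i * (g i - L)) =o[atTop] w := by
    have h1 : (fun i => g i - L) =o[atTop] fun _ => (1 : ℝ) := by
      rw [Asymptotics.isLittleO_one_iff]
      simpa using hg.sub_const L
    simpa using (Asymptotics.isBigO_refl w atTop).mul_isLittleO h1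
  have hs := ho.sum_range hw hW
  have h1 : Tendsto (fun n => (∑ i ∈ Finset.range n, w i * (g i - L)) / N n) atTop (𝓝 0) := by
    have h2 := hs.tendsto_div_nhds_zero.mul hB
    rw [zero_mul] at h2
    refine h2.congr' ?_
    filter_upwards [hW.eventually_gt_atTop 0] with n hn
    field_simp
  have h2 := h1.add (hB.mul_const L)
  rw [zero_add] at h2
  refine h2.congr fun n => ?_
  rw [div_mul_eq_mul_div, ← add_div, Finset.sum_mul, ← Finset.sum_add_distrib]
  congr 1
  exact Finset.sum_congr rfl fun i _ => by ring

end Toeplitz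

/-! ### Means of kernel weights -/

section Kernel

/-- A function that is continuous on `[0,1]` and vanishes elsewhere is Borel measurable. -/
lemma measurable_of_continuousOn_unit {k : ℝ → ℝ} (hk : ContinuousOn k (Set.Icc 0 1))
    (h0 : ∀ t, t ∉ Set.Icc (0 : ℝ) 1 → k t = 0) : Measurable k := by
  classical
  have e : k = (Set.Icc (0 : ℝ) 1).piecewise k fun _ => 0 := by
    ext t
    by_cases ht : t ∈ Set.Icc (0 : ℝ) 1
    · rw [Set.piecewise_eq_of_mem _ _ _ ht]
    · rw [Set.piecewise_eq_of_notMem _ _ _ ht, h0 t ht]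
  rw [e]
  exact hk.measurable_piecewise continuousOn_const measurableSet_Icc

lemma measurable_of_absolutelyContinuous {k : ℝ → ℝ} (hk : AbsolutelyContinuousOnInterval k 0 1)
    (h0 : ∀ t, t ∉ Set.Icc (0 : ℝ) 1 → k t = 0) : Measurable k :=
  measurable_of_continuousOn_unit (by simpa using hk.continuousOn) h0

/-- For `0 ≤ d` the value `k (d / u)` is an integral over levels of the indicators `d ≤ u s`. -/
lemma kernel_eq_sub_integral {k : ℝ → ℝ} (hk : AbsolutelyContinuousOnInterval k 0 1)
    (h0 : ∀ t, t ∉ Set.Icc (0 : ℝ) 1 → k t = 0) {u d : ℝ} (hu : 0 < u) (hd : 0 ≤ d) :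
    k (d / u) = k 1 * (Set.Iic u).indicator 1 d -
      ∫ s in (0 : ℝ)..1, deriv k s * (Set.Iic (u * s)).indicator 1 d := by
  have hdu : 0 ≤ d / u := div_nonneg hd hu.le
  have hind : ∀ s, (Set.Iic (u * s)).indicator (1 : ℝ → ℝ) d =
      (Set.Ici (d / u)).indicator 1 s := by
    intro s
    simp only [Set.indicator_apply, Set.mem_Iic, Set.mem_Ici, div_le_iff₀' hu, Pi.one_apply]
  simp only [hind]
  rcases le_or_gt d u with h | h
  · have h1 : d / u ≤ 1 := (div_le_one hu).2 h
    have hk1 : AbsolutelyContinuousOnInterval k (d / u) 1 := by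
      refine hk.mono ?_
      rw [Set.uIcc_of_le h1, Set.uIcc_of_le zero_le_one]
      exact Set.Icc_subset_Icc_left hdu
    have e : ∫ s in (0 : ℝ)..1, deriv k s * (Set.Ici (d / u)).indicator 1 s =
        ∫ s in (d / u)..1, deriv k s := by
      have e1 : (fun s => deriv k s * (Set.Ici (d / u)).indicator 1 s) =
          (Set.Ici (d / u)).indicator (deriv k) := by
        ext s
        by_cases hs : s ∈ Set.Ici (d / u) <;> simp [hs]
      rw [e1, intervalIntegral.integral_of_le zero_le_one, intervalIntegral.integral_of_le h1,
        setIntegral_indicator measurableSet_Ici, ← integral_Icc_eq_integral_Ioc (x := d / u)]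
      refine setIntegral_congr_set ?_
      rcases hdu.eq_or_lt with h00 | h00
      · rw [← h00]
        have : Set.Ioc (0 : ℝ) 1 ∩ Set.Ici 0 = Set.Ioc 0 1 :=
          Set.inter_eq_left.2 fun s hs => hs.1.le
        rw [this]
        exact Ioc_ae_eq_Icc
      · have : Set.Ioc (0 : ℝ) 1 ∩ Set.Ici (d / u) = Set.Icc (d / u) 1 := by
          ext s
          simp only [Set.mem_inter_iff, Set.mem_Ioc, Set.mem_Ici, Set.mem_Icc]
          constructor
          · rintro ⟨⟨_, h2⟩, h3⟩; exact ⟨h3, h2⟩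
          · rintro ⟨h2, h3⟩; exact ⟨⟨h00.trans_le h2, h3⟩, h2⟩
        rw [this]
        exact EventuallyEq.rfl
    rw [e, hk1.integral_deriv_eq_sub]
    simp [h]
  · have h1 : 1 < d / u := (one_lt_div hu).2 h
    rw [h0 _ fun hm => absurd hm.2 (not_le.2 h1)]
    have e : ∫ s in (0 : ℝ)..1, deriv k s * (Set.Ici (d / u)).indicator 1 s =
        ∫ s in (0 : ℝ)..1, (0 : ℝ) := by
      refine intervalIntegral.integral_congr fun s hs => ?_
      rw [Set.uIcc_of_le zero_le_one] at hs
      have : s ∉ Set.Ici (d / u) := fun hm => absurd (hm.trans hs.2) (not_le.2 h1)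
      simp [this]
    rw [e]
    simp [h]

variable {Ω : Type*} [MeasurableSpace Ω] {P : Measure Ω} [IsProbabilityMeasure P]

/-- Fubini's theorem turns the representation of `k (d / u)` into one of its mean. -/
lemma integral_kernel_eq {k : ℝ → ℝ} (hk : AbsolutelyContinuousOnInterval k 0 1)
    (h0 : ∀ t, t ∉ Set.Icc (0 : ℝ) 1 → k t = 0) {D : Ω → ℝ} (hD : Measurable D)
    (hD0 : ∀ ω, 0 ≤ D ω) {u : ℝ} (hu : 0 < u) :
    ∫ ω, k (D ω / u) ∂P = k 1 * P.real {ω | D ω ≤ u} -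
      ∫ s in (0 : ℝ)..1, deriv k s * P.real {ω | D ω ≤ u * s} := by
  have hint : IntervalIntegrable (deriv k) volume 0 1 := hk.intervalIntegrable_deriv
  have hint' : Integrable (deriv k) (volume.restrict (Set.Ioc 0 1)) := by
    rw [intervalIntegrable_iff_integrableOn_Ioc_of_le zero_le_one] at hint
    exact hint
  have hind : ∀ a : ℝ, ∫ ω, (Set.Iic a).indicator (1 : ℝ → ℝ) (D ω) ∂P =
      P.real {ω | D ω ≤ a} := by
    intro a
    have : (fun ω => (Set.Iic a).indicator (1 : ℝ → ℝ) (D ω)) =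
        (D ⁻¹' Set.Iic a).indicator 1 := rfl
    rw [this, integral_indicator_one (hD measurableSet_Iic)]
    rfl
  have hprod : Integrable (fun q : Ω × ℝ => deriv k q.2 *
      (Set.Iic (u * q.2)).indicator (1 : ℝ → ℝ) (D q.1))
      (P.prod (volume.restrict (Set.Ioc 0 1))) := by
    have hsnd : Integrable (fun q : Ω × ℝ => deriv k q.2)
        (P.prod (volume.restrict (Set.Ioc 0 1))) := hint'.comp_snd P
    have hset : MeasurableSet {q : Ω × ℝ | D q.1 ≤ u * q.2} :=
      measurableSet_le (hD.comp measurable_fst) (measurable_snd.const_mul u)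
    have e : (fun q : Ω × ℝ => deriv k q.2 * (Set.Iic (u * q.2)).indicator (1 : ℝ → ℝ) (D q.1)) =
        {q : Ω × ℝ | D q.1 ≤ u * q.2}.indicator fun q => deriv k q.2 := by
      ext q
      by_cases hq : D q.1 ≤ u * q.2 <;> simp [hq]
    rw [e]
    exact hsnd.indicator hset
  have hi1 : Integrable (fun ω => k 1 * (Set.Iic u).indicator (1 : ℝ → ℝ) (D ω)) P := by
    refine Integrable.const_mul ?_ _
    exact (integrable_const (1 : ℝ)).indicator (hD measurableSet_Iic)
  simp only [fun ω => kernel_eq_sub_integral hk h0 hu (hD0 ω),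
    intervalIntegral.integral_of_le (zero_le_one' ℝ)]
  rw [integral_sub hi1 hprod.integral_prod_left, integral_const_mul, hind,
    integral_integral_swap hprod]
  simp only [integral_const_mul, hind]

/-- The mean of a kernel weight is of the order of the small ball probability, with the constant
`k 1 - ∫₀¹ k' τ₀`. -/
lemma tendsto_integral_kernel_div {k : ℝ → ℝ} (hk : AbsolutelyContinuousOnInterval k 0 1)
    (h0 : ∀ t, t ∉ Set.Icc (0 : ℝ) 1 → k t = 0) {D : Ω → ℝ} (hD : Measurable D)
    (hD0 : ∀ ω, 0 ≤ D ω) {F τ₀ : ℝ → ℝ} (hF : ∀ t, F t = P.real {ω | D ω ≤ t})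
    (hpos : ∀ t, 0 < t → 0 < F t)
    (hτ : ∀ s ∈ Set.Icc (0 : ℝ) 1, Tendsto (fun u => F (u * s) / F u) (𝓝[>] 0) (𝓝 (τ₀ s))) :
    Tendsto (fun u => (∫ ω, k (D ω / u) ∂P) / F u) (𝓝[>] 0)
      (𝓝 (k 1 - ∫ s in (0 : ℝ)..1, deriv k s * τ₀ s)) := by
  have hmono : Monotone F := fun a b hab => by
    rw [hF, hF]
    exact measureReal_mono fun ω (hω : D ω ≤ a) => hω.trans hab
  have hlim : Tendsto (fun u => ∫ s in (0 : ℝ)..1, deriv k s * (F (u * s) / F u)) (𝓝[>] 0)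
      (𝓝 (∫ s in (0 : ℝ)..1, deriv k s * τ₀ s)) := by
    refine intervalIntegral.tendsto_integral_filter_of_dominated_convergence
      (fun s => ‖deriv k s‖) ?_ ?_ hk.intervalIntegrable_deriv.norm ?_
    · refine Eventually.of_forall fun u => ?_
      exact ((measurable_deriv k).mul ((hmono.measurable.comp
        (measurable_id.const_mul u)).div_const _)).aestronglyMeasurable
    · filter_upwards [self_mem_nhdsWithin] with u hu
      refine ae_of_all _ fun s hs => ?_
      rw [Set.uIoc_of_le zero_le_one] at hs
      have hFu := hpos u hu
      have h1 : F (u * s) ≤ F u := hmono (mul_le_of_le_one_right (le_of_lt hu) hs.2)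
      have h2 : 0 ≤ F (u * s) := by rw [hF]; positivity
      rw [norm_mul, Real.norm_of_nonneg (div_nonneg h2 hFu.le)]
      exact mul_le_of_le_one_right (norm_nonneg _) ((div_le_one hFu).2 h1)
    · refine ae_of_all _ fun s hs => ?_
      rw [Set.uIoc_of_le zero_le_one] at hs
      exact (hτ s ⟨hs.1.le, hs.2⟩).const_mul _
  refine (tendsto_const_nhds.sub hlim).congr' ?_
  filter_upwards [self_mem_nhdsWithin] with u hu
  have hFu := (hpos u hu).ne'
  rw [integral_kernel_eq hk h0 hD hD0 hu, sub_div, ← hF, mul_div_cancel_right₀ _ hFu,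
    ← intervalIntegral.integral_div]
  simp only [← hF, mul_div_assoc]

/-- A weight that is continuous at the centre only contributes its value there to the kernel
mean. -/
lemma tendsto_integral_mul_kernel_div {k : ℝ → ℝ} (hkm : Measurable k) (hk0 : ∀ t, 0 ≤ k t)
    {C : ℝ} (hkC : ∀ t, k t ≤ C) (h0 : ∀ t, t ∉ Set.Icc (0 : ℝ) 1 → k t = 0)
    {D : Ω → ℝ} (hD : Measurable D) {F : ℝ → ℝ} (hpos : ∀ t, 0 < t → 0 < F t)
    {M : ℝ} (hM : Tendsto (fun u => (∫ ω, k (D ω / u) ∂P) / F u) (𝓝[>] 0) (𝓝 M))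
    {w : Ω → ℝ} (hw : Integrable w P) {L : ℝ}
    (hwL : ∀ ε > 0, ∃ η > 0, ∀ ω, D ω < η → |w ω - L| < ε) :
    Tendsto (fun u => (∫ ω, w ω * k (D ω / u) ∂P) / F u) (𝓝[>] 0) (𝓝 (L * M)) := by
  have hki : ∀ u, AEStronglyMeasurable (fun ω => k (D ω / u)) P := fun u =>
    (hkm.comp (hD.div_const u)).aestronglyMeasurable
  have hkb : ∀ u, ∀ᵐ ω ∂P, ‖k (D ω / u)‖ ≤ C := fun u => ae_of_all _ fun ω => by
    rw [Real.norm_of_nonneg (hk0 _)]; exact hkC _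
  have hkI : ∀ u, Integrable (fun ω => k (D ω / u)) P := fun u =>
    Integrable.of_bound (hki u) C (hkb u)
  have hrem : Tendsto (fun u => (∫ ω, (w ω - L) * k (D ω / u) ∂P) / F u) (𝓝[>] 0) (𝓝 0) := by
    rw [Metric.tendsto_nhds]
    intro ε hε
    have hM1 : 0 < |M| + 1 := by positivity
    obtain ⟨η, hη, hwη⟩ := hwL (ε / (|M| + 1)) (by positivity)
    have hMlt : M < |M| + 1 := by linarith [le_abs_self M]
    filter_upwards [hM.eventually (gt_mem_nhds hMlt), self_mem_nhdsWithin,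
      mem_nhdsWithin_of_mem_nhds (gt_mem_nhds hη)] with u hu1 hu0 hu2
    have hFu := hpos u hu0
    have hbd : ‖∫ ω, (w ω - L) * k (D ω / u) ∂P‖ ≤ ε / (|M| + 1) * ∫ ω, k (D ω / u) ∂P := by
      rw [← integral_const_mul]
      refine norm_integral_le_of_norm_le ((hkI u).const_mul _) (ae_of_all _ fun ω => ?_)
      rw [norm_mul, Real.norm_of_nonneg (hk0 _), Real.norm_eq_abs]
      by_cases hω : D ω / u ∈ Set.Icc (0 : ℝ) 1
      · have : D ω < η := lt_of_le_of_lt ((div_le_one hu0).1 hω.2) hu2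
        exact mul_le_mul_of_nonneg_right (hwη ω this).le (hk0 _)
      · simp [h0 _ hω]
    rw [dist_zero_right, norm_div, Real.norm_of_nonneg hFu.le, div_lt_iff₀ hFu]
    rw [div_lt_iff₀ hFu] at hu1
    calc _ ≤ _ := hbd
      _ < ε / (|M| + 1) * ((|M| + 1) * F u) := by
        exact mul_lt_mul_of_pos_left hu1 (by positivity)
      _ = ε * F u := by field_simp
  have h1 := hrem.add (hM.const_mul L)
  rw [zero_add] at h1
  refine h1.congr fun u => ?_
  have hwk : Integrable (fun ω => w ω * k (D ω / u)) P := hw.mul_bdd (hki u) (hkb u)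
  have : ∫ ω, (w ω - L) * k (D ω / u) ∂P =
      ∫ ω, w ω * k (D ω / u) ∂P - L * ∫ ω, k (D ω / u) ∂P := by
    rw [← integral_const_mul, ← integral_sub hwk ((hkI u).const_mul L)]
    exact integral_congr_ae (ae_of_all _ fun ω => by ring)
  rw [this]
  ring

end Kernel

/-! ### Conditional expectations -/

section CondExp

variable {Ω : Type*} {m mΩ : MeasurableSpace Ω} {P : Measure Ω}

lemma integral_mul_eq_of_condExp_ae_eq [IsProbabilityMeasure P] (hm : m ≤ mΩ)
    {f f' g : Ω → ℝ} (hf : Integrable f P) (hff' : P[f | m] =ᵐ[P] f')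
    (hg : StronglyMeasurable[m] g) {C : ℝ} (hC : ∀ ω, ‖g ω‖ ≤ C) :
    ∫ ω, f ω * g ω ∂P = ∫ ω, f' ω * g ω ∂P := by
  have hfg : Integrable (fun ω => f ω * g ω) P :=
    hf.mul_bdd (hg.mono hm).aestronglyMeasurable (ae_of_all _ hC)
  rw [← integral_condExp hm]
  refine integral_congr_ae ?_
  filter_upwards [condExp_mul_of_stronglyMeasurable_right hg hfg hf, hff'] with ω h1 h2
  rw [← h2]
  exact h1

/-- If `f` is small where `D` is small, so is its conditional expectation given `D`. -/
lemma ae_abs_condExp_le_of_lt {f D : Ω → ℝ} (hf : Integrable f P)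
    (hD : Measurable[m] D) {η ε : ℝ} (hε : 0 ≤ ε) (h : ∀ ω, D ω < η → |f ω| ≤ ε) :
    ∀ᵐ ω ∂P, D ω < η → |(P[f | m]) ω| ≤ ε := by
  have hA : MeasurableSet[m] (D ⁻¹' Set.Iio η) := hD measurableSet_Iio
  have hb : ∀ᵐ ω ∂P, |(D ⁻¹' Set.Iio η).indicator f ω| ≤ ε := ae_of_all _ fun ω => by
    by_cases hω : D ω < η
    · simpa [hω] using h ω hω
    · simpa [hω] using hε
  filter_upwards [ae_bdd_abs_condExp_of_ae_bdd_abs (m := m) hb,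
    condExp_indicator hf hA] with ω h1 h2 hω
  rw [h2] at h1
  simpa [hω] using h1

end CondExp

/-! ### Consequences of the exponential moment -/

section Moments

/-- Half of the exponential moment absorbs a square. -/
lemma exists_sq_le_mul_exp {lam μ : ℝ} (hlam : 0 < lam) (hμ : 0 < μ) :
    ∃ C : ℝ, 0 < C ∧ ∀ y : ℝ, 0 ≤ y → y ^ 2 ≤ C * Real.exp (lam / 2 * y ^ μ) := by
  have ht := tendsto_rpow_mul_exp_neg_mul_atTop_nhds_zero (2 / μ) (lam / 2) (half_pos hlam)
  obtain ⟨Z, hZ⟩ := (eventually_atTop.1 (ht.eventually (gt_mem_nhds one_pos)))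
  refine ⟨max 1 (|Z| ^ (2 / μ)), by positivity, fun y hy => ?_⟩
  have hz : 0 ≤ y ^ μ := Real.rpow_nonneg hy _
  have e : y ^ 2 = (y ^ μ) ^ (2 / μ) := by
    rw [← Real.rpow_mul hy, mul_div_cancel₀ _ hμ.ne']
    exact (Real.rpow_two y).symm
  rw [e]
  rcases le_total Z (y ^ μ) with h | h
  · have h1 := (hZ _ h).le
    have h2 : (y ^ μ) ^ (2 / μ) = (y ^ μ) ^ (2 / μ) * Real.exp (-(lam / 2) * y ^ μ) *
        Real.exp (lam / 2 * y ^ μ) := by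
      rw [mul_assoc, ← Real.exp_add]
      simp
    rw [h2]
    exact mul_le_mul_of_nonneg_right (h1.trans (le_max_left _ _)) (Real.exp_pos _).le
  · have h1 : (y ^ μ) ^ (2 / μ) ≤ |Z| ^ (2 / μ) :=
      Real.rpow_le_rpow hz (h.trans (le_abs_self _)) (by positivity)
    have h2 : 1 ≤ Real.exp (lam / 2 * y ^ μ) := Real.one_le_exp (by positivity)
    exact (h1.trans (le_max_right _ _)).trans (le_mul_of_one_le_right (by positivity) h2)

variable {Ω : Type*} [MeasurableSpace Ω] {P : Measure Ω} {Y : Ω → ℝ}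

lemma H5.memLp_two (h5 : H5 P Y) (hY : Measurable Y) : MemLp Y 2 P := by
  obtain ⟨lam, hlam, μ, hμ, hint⟩ := h5
  obtain ⟨C, hC, hbd⟩ := exists_sq_le_mul_exp hlam hμ
  rw [memLp_two_iff_integrable_sq hY.aestronglyMeasurable]
  refine (hint.const_mul C).mono' (hY.pow_const 2).aestronglyMeasurable (ae_of_all _ fun ω => ?_)
  rw [Real.norm_of_nonneg (sq_nonneg _), ← sq_abs]
  refine (hbd _ (abs_nonneg _)).trans (mul_le_mul_of_nonneg_left (Real.exp_le_exp.2 ?_) hC.le)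
  have : 0 ≤ |Y ω| ^ μ := Real.rpow_nonneg (abs_nonneg _) _
  nlinarith

/-- Under an exponential moment, truncation of `Y` at a level that outgrows every power of `ln n`
leaves a second moment of order `o(1/n)`. -/
lemma H5.tendsto_truncated (h5 : H5 P Y) {s : ℕ → ℝ}
    (hs : Tendsto s atTop atTop)
    (hlog : ∀ δ : ℝ, 0 < δ → Tendsto (fun n : ℕ => Real.log n ^ δ / s n) atTop (𝓝 0))
    {κ : ℝ} (hκ : 0 < κ) :
    Tendsto (fun n : ℕ => n * ∫ ω, {ω | κ * s n < |Y ω|}.indicator (fun ω => Y ω ^ 2) ω ∂P)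
      atTop (𝓝 0) := by
  obtain ⟨lam, hlam, μ, hμ, hint⟩ := h5
  obtain ⟨C, hC, hbd⟩ := exists_sq_le_mul_exp hlam hμ
  have hln : Tendsto (fun n : ℕ => Real.log n) atTop atTop :=
    Real.tendsto_log_atTop.comp tendsto_natCast_atTop_atTop
  have hup : Tendsto (fun n : ℕ => C * (∫ ω, Real.exp (lam * |Y ω| ^ μ) ∂P) / (n : ℝ)) atTop
      (𝓝 0) := tendsto_const_div_atTop_nhds_zero_nat _
  refine squeeze_zero' (Eventually.of_forall fun n => mul_nonneg n.cast_nonneg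
    (integral_nonneg fun ω => Set.indicator_nonneg (fun _ _ => sq_nonneg _) _)) ?_ hup
  filter_upwards [(hlog (2 / μ) (by positivity)).eventually (gt_mem_nhds hκ),
    hs.eventually_gt_atTop 0, hln.eventually_ge_atTop (4 / lam), eventually_gt_atTop 0]
    with n h1 h2 h3 h4
  have hn : (0 : ℝ) < n := Nat.cast_pos.2 h4
  rw [div_lt_iff₀ h2] at h1
  have hl0 : 0 ≤ Real.log n := (by positivity : 0 ≤ 4 / lam).trans h3
  have hpt : ∀ ω, {ω | κ * s n < |Y ω|}.indicator (fun ω => Y ω ^ 2) ω ≤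
      C / (n : ℝ) ^ 2 * Real.exp (lam * |Y ω| ^ μ) := by
    intro ω
    by_cases hω : κ * s n < |Y ω|
    · have e : {ω | κ * s n < |Y ω|}.indicator (fun ω => Y ω ^ 2) ω = Y ω ^ 2 := by simp [hω]
      rw [e, ← sq_abs]
      -- on this event `|Y|^μ ≥ (ln n)²`, so that `exp (lam |Y|^μ / 2) ≥ n²`
      have hy : Real.log n ^ 2 ≤ |Y ω| ^ μ := by
        have := Real.rpow_le_rpow (by positivity) (h1.trans hω).le hμ.le
        rwa [← Real.rpow_mul hl0, div_mul_cancel₀ _ hμ.ne', Real.rpow_two] at this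
      have hn2 : (n : ℝ) ^ 2 ≤ Real.exp (lam / 2 * |Y ω| ^ μ) := by
        have e2 : (n : ℝ) ^ 2 = Real.exp (2 * Real.log n) := by
          rw [two_mul, Real.exp_add, Real.exp_log hn, sq]
        rw [e2, Real.exp_le_exp]
        rw [div_le_iff₀ hlam] at h3
        nlinarith
      have e3 : Real.exp (lam * |Y ω| ^ μ) =
          Real.exp (lam / 2 * |Y ω| ^ μ) * Real.exp (lam / 2 * |Y ω| ^ μ) := by
        rw [← Real.exp_add]; congr 1; ring
      refine (hbd _ (abs_nonneg _)).trans ?_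
      rw [e3, ← mul_assoc]
      refine mul_le_mul_of_nonneg_right ?_ (Real.exp_pos _).le
      rw [div_mul_eq_mul_div, le_div_iff₀ (by positivity)]
      exact mul_le_mul_of_nonneg_left hn2 hC.le
    · have e : {ω | κ * s n < |Y ω|}.indicator (fun ω => Y ω ^ 2) ω = 0 := by simp [hω]
      rw [e]
      positivity
  have hI := integral_mono_of_nonneg
    (ae_of_all P fun ω => Set.indicator_nonneg (fun _ _ => sq_nonneg _) _)
    (hint.const_mul (C / (n : ℝ) ^ 2)) (ae_of_all P hpt)
  rw [integral_const_mul] at hI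
  refine (mul_le_mul_of_nonneg_left hI hn.le).trans (le_of_eq ?_)
  field_simp

end Moments

/-! ### Small ball probabilities and bandwidths -/

section SmallBall

variable {Ω E : Type*} [MeasurableSpace Ω] [AddCommGroup E] [Module ℝ E]
  {P : Measure Ω} [IsProbabilityMeasure P] {p : Seminorm ℝ E} {χ : E} {X : Ω → E} {h : ℕ → ℝ}

lemma smallBall_mono : Monotone (smallBall P p X χ) := fun _ _ hab =>
  measureReal_mono fun _ hω => le_trans hω hab

/-- Bandwidths tend to `0` and `F(h_n) > 0` for large `n`, so `F` is positive on `(0, ∞)`. -/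
lemma smallBall_pos (hh : Tendsto h atTop (𝓝 0))
    (hN : Tendsto (fun n : ℕ => (n : ℝ) * smallBall P p X χ (h n)) atTop atTop)
    {t : ℝ} (ht : 0 < t) : 0 < smallBall P p X χ t := by
  obtain ⟨n, h1, h2⟩ := ((hh.eventually (gt_mem_nhds ht)).and (hN.eventually_gt_atTop 0)).exists
  have h3 : 0 < smallBall P p X χ (h n) := pos_of_mul_pos_right h2 n.cast_nonneg
  exact h3.trans_le (smallBall_mono h1.le)

end SmallBall

section Assumptions

/-- The Cauchy–Schwarz inequality forces `β_{[1]} β_{[-1]} ≥ 1`. -/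
lemma H4.beta_one_pos {h : ℕ → ℝ} {l α : ℝ} {β : ℝ → ℝ} {F : ℝ → ℝ}
    (h4 : H4 F h l α β) (hF : ∀ n, 1 ≤ n → 0 < F (h n)) : 0 < β 1 := by
  have hprod := (h4.tendsto_B 1 (by norm_num)).mul (h4.tendsto_B (-1) (by norm_num))
  have hge : 1 ≤ β 1 * β (-1) := by
    refine ge_of_tendsto hprod ?_
    filter_upwards [eventually_ge_atTop 1] with n hn
    have hcs := Finset.sum_sq_le_sum_mul_sum_of_sq_le_mul (Finset.Icc 1 n)
      (r := fun _ => (1 : ℝ)) (f := fun i => (F (h i) / F (h n)) ^ (1 : ℝ))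
      (g := fun i => (F (h i) / F (h n)) ^ (-1 : ℝ)) ?_ ?_ ?_
    · simp only [Finset.sum_const, Nat.card_Icc, add_tsub_cancel_right, nsmul_eq_mul,
        mul_one] at hcs
      have hn0 : (0 : ℝ) < n := Nat.cast_pos.2 hn
      rw [mul_mul_mul_comm, ← sq, div_pow, one_pow, div_mul_eq_mul_div, one_mul,
        le_div_iff₀ (by positivity), one_mul]
      exact hcs
    · exact fun i hi => (Real.rpow_pos_of_pos
        (div_pos (hF i (Finset.mem_Icc.1 hi).1) (hF n hn)) _).le
    · exact fun i hi => (Real.rpow_pos_of_pos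
        (div_pos (hF i (Finset.mem_Icc.1 hi).1) (hF n hn)) _).le
    · intro i hi
      rw [← Real.rpow_add (div_pos (hF i (Finset.mem_Icc.1 hi).1) (hF n hn))]
      norm_num
  have h0 : 0 ≤ β 1 := by
    refine ge_of_tendsto (h4.tendsto_B 1 (by norm_num)) ?_
    filter_upwards [eventually_ge_atTop 1] with n hn
    refine mul_nonneg (by positivity) (Finset.sum_nonneg fun i hi => ?_)
    exact (Real.rpow_pos_of_pos
        (div_pos (hF i (Finset.mem_Icc.1 hi).1) (hF n hn)) _).le
  rcases h0.eq_or_lt with h00 | h00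
  · rw [← h00, zero_mul] at hge
    linarith
  · exact h00

variable {K : ℝ → ℝ}

lemma H2.measurable (h2 : H2 K) : Measurable K :=
  measurable_of_absolutelyContinuous h2.absolutelyContinuous h2.support

lemma H2.absolutelyContinuous_sq (h2 : H2 K) :
    AbsolutelyContinuousOnInterval (fun t => K t ^ 2) 0 1 := by
  have := h2.absolutelyContinuous.mul h2.absolutelyContinuous
  have e : K * K = fun t => K t ^ 2 := by ext t; simp [sq]
  rwa [e] at this

lemma H2.support_sq (h2 : H2 K) : ∀ t, t ∉ Set.Icc (0 : ℝ) 1 → K t ^ 2 = 0 := fun t ht => by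
  rw [h2.support t ht]; norm_num

lemma H2.exists_bound_pos (h2 : H2 K) : ∃ C > 0, ∀ t, K t ≤ C := by
  obtain ⟨C, hC⟩ := h2.bounded
  exact ⟨max C 1, by positivity, fun t => (hC t).trans (le_max_left _ _)⟩

lemma ContinuousNear.exists_lt {E : Type*} [AddCommGroup E] [Module ℝ E] {p : Seminorm ℝ E}
    {χ : E} {g : E → ℝ} (hg : ContinuousNear p g χ) :
    ∀ ε > 0, ∃ η > 0, ∀ x, p (χ - x) < η → |g x - g χ| < ε := by
  obtain ⟨ρ, hρ, h⟩ := hg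
  intro ε hε
  obtain ⟨η, hη, h'⟩ := h χ (by simpa using hρ) ε hε
  exact ⟨η, hη, fun x hx => h' x (by rwa [map_sub_rev])⟩

end Assumptions

/-! ### The regression model -/

section Regression

variable {Ω E : Type*} [MeasurableSpace E] {X : Ω → E}

/-- Functions of the covariate only are measurable for the conditioning `σ`-field. -/
lemma stronglyMeasurable_comap {g : E → ℝ} (hg : Measurable g) (X : Ω → E) :
    StronglyMeasurable[MeasurableSpace.comap X inferInstance] fun ω => g (X ω) :=
  (hg.comp (comap_measurable X)).stronglyMeasurable

variable [MeasurableSpace Ω] {P : Measure Ω} {Y : Ω → ℝ} {r sigmaSq : E → ℝ}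

lemma IsRegressionModel.integrable_r (hm : IsRegressionModel P X Y r sigmaSq) :
    Integrable (fun ω => r (X ω)) P := integrable_condExp.congr hm.condExp_Y

lemma IsRegressionModel.integrable_sigmaSq (hm : IsRegressionModel P X Y r sigmaSq) :
    Integrable (fun ω => sigmaSq (X ω)) P := integrable_condExp.congr hm.condExp_sq

lemma IsRegressionModel.memLp_eps (hm : IsRegressionModel P X Y r sigmaSq) :
    MemLp (fun ω => Y ω - r (X ω)) 2 P :=
  (memLp_two_iff_integrable_sq (hm.measurable_Y.sub
    (hm.measurable_r.comp hm.measurable_X)).aestronglyMeasurable).2 hm.integrable_sq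

lemma IsRegressionModel.memLp_r (hm : IsRegressionModel P X Y r sigmaSq) (h5 : H5 P Y) :
    MemLp (fun ω => r (X ω)) 2 P := by
  have := (h5.memLp_two hm.measurable_Y).sub hm.memLp_eps
  refine this.ae_eq (ae_of_all _ fun ω => ?_)
  simp

lemma IsRegressionModel.integral_eps_mul [IsProbabilityMeasure P]
    (hm : IsRegressionModel P X Y r sigmaSq) {g : E → ℝ}
    (hg : Measurable g) {C : ℝ} (hC : ∀ x, ‖g x‖ ≤ C) :
    ∫ ω, (Y ω - r (X ω)) * g (X ω) ∂P = 0 := by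
  have h1 := integral_mul_eq_of_condExp_ae_eq hm.measurable_X.comap_le hm.integrable_Y
    hm.condExp_Y (stronglyMeasurable_comap hg X) fun ω => hC (X ω)
  have hb : ∀ f : Ω → ℝ, Integrable f P → Integrable (fun ω => f ω * g (X ω)) P := fun f hf =>
    hf.mul_bdd (hg.comp hm.measurable_X).aestronglyMeasurable (ae_of_all _ fun ω => hC (X ω))
  simp only [sub_mul]
  rw [integral_sub (hb _ hm.integrable_Y) (hb _ hm.integrable_r), h1, sub_self]

end Regression

/-! ### Population moments of the kernel weights -/

section Model

variable {Ω E : Type*} [MeasurableSpace Ω] [AddCommGroup E] [Module ℝ E] [MeasurableSpace E]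
  {P : Measure Ω} [IsProbabilityMeasure P] {p : Seminorm ℝ E} {χ : E}
  {X : Ω → E} {Y : Ω → ℝ} {r sigmaSq : E → ℝ} {K τ₀ : ℝ → ℝ}

lemma measurable_semidist (hp : Measurable fun x : E => p (χ - x)) (hX : Measurable X) :
    Measurable fun ω => p (χ - X ω) := hp.comp hX

lemma tendsto_integral_K_div (hp : Measurable fun x : E => p (χ - x)) (hX : Measurable X)
    (h2 : H2 K) (h3 : H3 (smallBall P p X χ) τ₀) (hF : ∀ t, 0 < t → 0 < smallBall P p X χ t) :
    Tendsto (fun u => (∫ ω, K (p (χ - X ω) / u) ∂P) / smallBall P p X χ u) (𝓝[>] 0)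
      (𝓝 (M1 K τ₀)) :=
  tendsto_integral_kernel_div h2.absolutelyContinuous h2.support (measurable_semidist hp hX)
    (fun _ => apply_nonneg p _) (fun _ => rfl) hF h3

lemma tendsto_integral_K_sq_div (hp : Measurable fun x : E => p (χ - x)) (hX : Measurable X)
    (h2 : H2 K) (h3 : H3 (smallBall P p X χ) τ₀) (hF : ∀ t, 0 < t → 0 < smallBall P p X χ t) :
    Tendsto (fun u => (∫ ω, K (p (χ - X ω) / u) ^ 2 ∂P) / smallBall P p X χ u) (𝓝[>] 0)
      (𝓝 (M2 K τ₀)) :=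
  tendsto_integral_kernel_div (k := fun t => K t ^ 2) h2.absolutelyContinuous_sq h2.support_sq
    (measurable_semidist hp hX) (fun _ => apply_nonneg p _) (fun _ => rfl) hF h3

/-- A kernel bounded below by `c > 0` on `[0,1]` has a positive limiting normalised mean. -/
lemma kernel_limit_pos {k : ℝ → ℝ} (hkm : Measurable k) (hk0 : ∀ t, 0 ≤ k t)
    {C : ℝ} (hkC : ∀ t, k t ≤ C) {c : ℝ} (hc : 0 < c) (hkc : ∀ t ∈ Set.Icc (0 : ℝ) 1, c ≤ k t)
    (hp : Measurable fun x : E => p (χ - x)) (hX : Measurable X)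
    (hF : ∀ t, 0 < t → 0 < smallBall P p X χ t) {M : ℝ}
    (hM : Tendsto (fun u => (∫ ω, k (p (χ - X ω) / u) ∂P) / smallBall P p X χ u) (𝓝[>] 0)
      (𝓝 M)) : 0 < M := by
  refine hc.trans_le (ge_of_tendsto hM ?_)
  filter_upwards [self_mem_nhdsWithin] with u hu
  have hD := measurable_semidist hp hX
  rw [le_div_iff₀ (hF u hu)]
  have hset : MeasurableSet {ω | p (χ - X ω) ≤ u} := hD measurableSet_Iic
  have e : c * smallBall P p X χ u = ∫ ω, {ω | p (χ - X ω) ≤ u}.indicator (fun _ => c) ω ∂P := by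
    rw [integral_indicator_const _ hset, smul_eq_mul, mul_comm]; rfl
  rw [e]
  refine integral_mono ((integrable_const c).indicator hset)
    (Integrable.of_bound (hkm.comp (hD.div_const u)).aestronglyMeasurable C
      (ae_of_all _ fun ω => ?_)) fun ω => ?_
  · rw [Real.norm_of_nonneg (hk0 _)]; exact hkC _
  · refine Set.indicator_le' (g := fun ω => k (p (χ - X ω) / u))
      (fun ω (hω : p (χ - X ω) ≤ u) => ?_) (fun _ _ => hk0 _) ω
    exact hkc _ ⟨div_nonneg (apply_nonneg p _) (le_of_lt hu), (div_le_one hu).2 hω⟩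

lemma M1_pos (hp : Measurable fun x : E => p (χ - x)) (hX : Measurable X)
    (h2 : H2 K) (h3 : H3 (smallBall P p X χ) τ₀) (hF : ∀ t, 0 < t → 0 < smallBall P p X χ t) :
    0 < M1 K τ₀ := by
  obtain ⟨C, hC⟩ := h2.bounded
  obtain ⟨c, hc, hcK⟩ := h2.inf_pos
  exact kernel_limit_pos h2.measurable h2.nonneg hC hc hcK hp hX hF
    (tendsto_integral_K_div hp hX h2 h3 hF)

lemma M2_pos (hp : Measurable fun x : E => p (χ - x)) (hX : Measurable X)
    (h2 : H2 K) (h3 : H3 (smallBall P p X χ) τ₀) (hF : ∀ t, 0 < t → 0 < smallBall P p X χ t) :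
    0 < M2 K τ₀ := by
  obtain ⟨C, hC⟩ := h2.bounded
  obtain ⟨c, hc, hcK⟩ := h2.inf_pos
  exact kernel_limit_pos (k := fun t => K t ^ 2) (h2.measurable.pow_const 2)
    (fun _ => sq_nonneg _) (C := C ^ 2) (fun t => pow_le_pow_left₀ (h2.nonneg t) (hC t) 2)
    (sq_pos_of_pos hc) (fun t ht => pow_le_pow_left₀ hc.le (hcK t ht) 2) hp hX hF
    (tendsto_integral_K_sq_div hp hX h2 h3 hF)

/-- The second moment of `ε K(‖χ - 𝒳‖/u)` is equivalent to `σ²(χ) M₂ F(u)`. -/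
lemma tendsto_integral_eps_sq_div (hm : IsRegressionModel P X Y r sigmaSq)
    (hp : Measurable fun x : E => p (χ - x)) (hσ : ContinuousNear p sigmaSq χ)
    (h2 : H2 K) (h3 : H3 (smallBall P p X χ) τ₀) (hF : ∀ t, 0 < t → 0 < smallBall P p X χ t) :
    Tendsto (fun u => (∫ ω, (Y ω - r (X ω)) ^ 2 * K (p (χ - X ω) / u) ^ 2 ∂P) /
      smallBall P p X χ u) (𝓝[>] 0) (𝓝 (sigmaSq χ * M2 K τ₀)) := by
  obtain ⟨C, hC⟩ := h2.bounded
  have hC2 : ∀ t, K t ^ 2 ≤ C ^ 2 := fun t => pow_le_pow_left₀ (h2.nonneg t) (hC t) 2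
  have hlim := tendsto_integral_mul_kernel_div (k := fun t => K t ^ 2)
    (h2.measurable.pow_const 2) (fun _ => sq_nonneg _) hC2 h2.support_sq
    (measurable_semidist hp hm.measurable_X) hF
    (tendsto_integral_K_sq_div hp hm.measurable_X h2 h3 hF) hm.integrable_sigmaSq
    (L := sigmaSq χ) fun ε hε => by
      obtain ⟨η, hη, h⟩ := hσ.exists_lt ε hε
      exact ⟨η, hη, fun ω hω => h (X ω) hω⟩
  refine hlim.congr fun u => ?_
  have := integral_mul_eq_of_condExp_ae_eq hm.measurable_X.comap_le hm.integrable_sq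
    hm.condExp_sq (stronglyMeasurable_comap (((h2.measurable.comp (hp.div_const u)).pow_const 2)) X)
    (C := C ^ 2) fun ω => by
      rw [Real.norm_of_nonneg (sq_nonneg _)]
      exact hC2 _
  rw [show (∫ ω, (Y ω - r (X ω)) ^ 2 * K (p (χ - X ω) / u) ^ 2 ∂P) =
    ∫ ω, sigmaSq (X ω) * K (p (χ - X ω) / u) ^ 2 ∂P from this]

lemma tendsto_integral_bias_sq_div (hm : IsRegressionModel P X Y r sigmaSq) (h5 : H5 P Y)
    (hp : Measurable fun x : E => p (χ - x)) (hr : ContinuousNear p r χ)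
    (h2 : H2 K) (h3 : H3 (smallBall P p X χ) τ₀) (hF : ∀ t, 0 < t → 0 < smallBall P p X χ t) :
    Tendsto (fun u => (∫ ω, (r (X ω) - r χ) ^ 2 * K (p (χ - X ω) / u) ^ 2 ∂P) /
      smallBall P p X χ u) (𝓝[>] 0) (𝓝 0) := by
  obtain ⟨C, hC⟩ := h2.bounded
  have hlim := tendsto_integral_mul_kernel_div (k := fun t => K t ^ 2)
    (h2.measurable.pow_const 2) (fun _ => sq_nonneg _)
    (fun t => pow_le_pow_left₀ (h2.nonneg t) (hC t) 2) h2.support_sq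
    (measurable_semidist hp hm.measurable_X) hF
    (tendsto_integral_K_sq_div hp hm.measurable_X h2 h3 hF)
    (w := fun ω => (r (X ω) - r χ) ^ 2) ((hm.memLp_r h5).sub (memLp_const _)).integrable_sq
    (L := 0) fun ε hε => by
      obtain ⟨η, hη, h⟩ := hr.exists_lt (√ε) (Real.sqrt_pos.2 hε)
      refine ⟨η, hη, fun ω hω => ?_⟩
      rw [sub_zero, abs_of_nonneg (sq_nonneg _), ← sq_abs]
      calc |r (X ω) - r χ| ^ 2 < √ε ^ 2 :=
            pow_lt_pow_left₀ (h (X ω) hω) (abs_nonneg _) (by norm_num)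
        _ = ε := Real.sq_sqrt hε.le
  simpa using hlim

/-- The regression function contributes a bias of order `u F(u)`. As `r` is continuous at `χ`, the
version `φ` of the conditional mean of `r(𝒳) - r(χ)` given the distance vanishes at `0`, whence
`φ(t) = O(t)`. -/
lemma exists_integral_bias_le (hm : IsRegressionModel P X Y r sigmaSq)
    (hp : Measurable fun x : E => p (χ - x)) (h1 : H1 P p X r sigmaSq χ)
    (h2 : H2 K) (hF : ∀ t, 0 < t → 0 < smallBall P p X χ t) :
    ∃ C : ℝ, ∀ᶠ u in 𝓝[>] 0,
      |∫ ω, (r (X ω) - r χ) * K (p (χ - X ω) / u) ∂P| ≤ C * (u * smallBall P p X χ u) := by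
  obtain ⟨CK, hCK0, hCK⟩ := h2.exists_bound_pos
  obtain ⟨φ, -, hφ, hdiff⟩ := h1.differentiable_phi
  set D : Ω → ℝ := fun ω => p (X ω - χ) with hDdef
  have hDeq : ∀ ω, D ω = p (χ - X ω) := fun ω => map_sub_rev p _ _
  have hD : Measurable D := by
    have : D = fun ω => p (χ - X ω) := funext hDeq
    rw [this]
    exact measurable_semidist hp hm.measurable_X
  have hmle : MeasurableSpace.comap D (borel ℝ) ≤ (inferInstance : MeasurableSpace Ω) := by
    rw [← BorelSpace.measurable_eq (α := ℝ)]
    exact hD.comap_le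
  have hDm : Measurable[MeasurableSpace.comap D (borel ℝ)] D := by
    rw [← BorelSpace.measurable_eq (α := ℝ)]
    exact comap_measurable D
  have hf : Integrable (fun ω => r (X ω) - r χ) P := hm.integrable_r.sub (integrable_const _)
  -- otherwise `|φ|` exceeds `|φ 0| / 2` near `0`, while continuity of `r` keeps `|φ(D)|` below that
  -- value almost surely on a small ball, which would then be null
  have hφ0 : φ 0 = 0 := by
    by_contra hne
    have hpos : 0 < |φ 0| := abs_pos.2 hne
    have hcont := (hdiff.continuousWithinAt.abs).eventually (lt_mem_nhds (half_lt_self hpos))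
    obtain ⟨δ, hδ, hδφ⟩ := Metric.mem_nhdsWithin_iff.1 hcont
    obtain ⟨η, hη, hηr⟩ := h1.continuous_r.exists_lt (|φ 0| / 2) (half_pos hpos)
    have hae := ae_abs_condExp_le_of_lt hf hDm (η := η) (half_pos hpos).le fun ω hω =>
      (hηr (X ω) (by rwa [← hDeq])).le
    set t := min δ η / 2 with ht
    have hmin : 0 < min δ η := lt_min hδ hη
    have ht0 : 0 < t := half_pos hmin
    have htlt : t < min δ η := half_lt_self hmin
    have hzero : smallBall P p X χ t = 0 := by
      rw [smallBall, measureReal_eq_zero_iff]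
      refine measure_mono_null ?_ (ae_iff.1 (hae.and hφ))
      intro ω hω
      have hω' : D ω ≤ t := by rw [hDeq]; exact hω
      have hlt := hω'.trans_lt htlt
      rintro ⟨ha, hb⟩
      have h3 := ha (hlt.trans_le (min_le_right _ _))
      rw [hb] at h3
      have h0 : 0 ≤ D ω := apply_nonneg p _
      have h4 : |φ 0| / 2 < |φ (D ω)| := hδφ ⟨by
        rw [Metric.mem_ball, Real.dist_eq, sub_zero, abs_of_nonneg h0]
        exact hlt.trans_le (min_le_left _ _), h0⟩
      linarith
    exact absurd hzero (hF t ht0).ne'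
  obtain ⟨C, hC⟩ := hdiff.isBigO_sub.bound
  obtain ⟨δ, hδ, hδφ⟩ := Metric.mem_nhdsWithin_iff.1 hC
  have hφle : ∀ t, 0 ≤ t → t < δ → |φ t| ≤ |C| * t := fun t h0 hlt => by
    have : ‖φ t - φ 0‖ ≤ C * ‖t - 0‖ := hδφ ⟨by
      rw [Metric.mem_ball, Real.dist_eq, sub_zero, abs_of_nonneg h0]
      exact hlt, h0⟩
    rw [hφ0, sub_zero, sub_zero, Real.norm_eq_abs, Real.norm_of_nonneg h0] at this
    exact this.trans (mul_le_mul_of_nonneg_right (le_abs_self C) h0)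
  refine ⟨|C| * CK, ?_⟩
  filter_upwards [self_mem_nhdsWithin, mem_nhdsWithin_of_mem_nhds (gt_mem_nhds hδ)] with u hu0 hu
  have hu0' : 0 < u := hu0
  have hgm : StronglyMeasurable[MeasurableSpace.comap D (borel ℝ)] fun ω => K (D ω / u) :=
    ((h2.measurable.comp (measurable_id.div_const u)).comp hDm).stronglyMeasurable
  have heq := integral_mul_eq_of_condExp_ae_eq hmle hf hφ hgm (C := CK) fun ω => by
    rw [Real.norm_of_nonneg (h2.nonneg _)]
    exact hCK _
  simp only [← hDeq]
  rw [heq]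
  have hset : MeasurableSet {ω | p (χ - X ω) ≤ u} :=
    measurable_semidist hp hm.measurable_X measurableSet_Iic
  have e : |C| * CK * (u * smallBall P p X χ u) =
      ∫ ω, {ω | p (χ - X ω) ≤ u}.indicator (fun _ => |C| * CK * u) ω ∂P := by
    rw [integral_indicator_const _ hset, smul_eq_mul, smallBall]; ring
  rw [e, ← Real.norm_eq_abs]
  refine norm_integral_le_of_norm_le ((integrable_const _).indicator hset)
    (ae_of_all _ fun ω => ?_)
  have h0 : 0 ≤ D ω := apply_nonneg p _
  rw [norm_mul, Real.norm_of_nonneg (h2.nonneg _), Real.norm_eq_abs]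
  by_cases hω : D ω ≤ u
  · have hmem : ω ∈ {ω | p (χ - X ω) ≤ u} := by rw [Set.mem_ofPred_eq, ← hDeq]; exact hω
    rw [Set.indicator_of_mem hmem]
    calc |φ (D ω)| * K (D ω / u) ≤ (|C| * u) * CK :=
          mul_le_mul ((hφle _ h0 (hω.trans_lt hu)).trans
            (mul_le_mul_of_nonneg_left hω (abs_nonneg C))) (hCK _) (h2.nonneg _)
            (mul_nonneg (abs_nonneg C) hu0'.le)
      _ = |C| * CK * u := by ring
  · have hk : K (D ω / u) = 0 :=
      h2.support _ fun hmem => hω ((div_le_one hu0').1 hmem.2)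
    rw [hk, mul_zero]
    exact Set.indicator_nonneg (fun _ _ => by positivity) _

end Model

lemma sum_Icc_one_eq_sum_range (f : ℕ → ℝ) (n : ℕ) :
    ∑ i ∈ Finset.Icc 1 n, f i = ∑ i ∈ Finset.range n, f (i + 1) := by
  rw [Finset.range_eq_Ico, Finset.sum_Ico_add' f 0 n 1]
  rfl

/-! ### Sums over the bandwidths -/

section Bandwidths

variable {F : ℝ → ℝ} {h : ℕ → ℝ} {l α : ℝ} {β : ℝ → ℝ}

lemma H4.tendsto_sum_F_div (h4 : H4 F h l α β) :
    Tendsto (fun n : ℕ => (∑ i ∈ Finset.range n, F (h (i + 1))) / (n * F (h n))) atTop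
      (𝓝 (β 1)) := by
  refine (h4.tendsto_B 1 (by norm_num)).congr fun n => ?_
  simp only [Real.rpow_one]
  rw [sum_Icc_one_eq_sum_range fun i => F (h i) / F (h n), ← Finset.sum_div]
  rw [one_div_mul_eq_div, div_div, mul_comm]

lemma H4.tendsto_succ (h4 : H4 F h l α β) (hpos : ∀ n, 1 ≤ n → 0 < h n) :
    Tendsto (fun i => h (i + 1)) atTop (𝓝[>] 0) :=
  tendsto_nhdsWithin_iff.2 ⟨(tendsto_add_atTop_iff_nat 1).2 h4.tendsto_h,
    Eventually.of_forall fun i => hpos (i + 1) (Nat.le_add_left 1 i)⟩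

/-- If `G u ∼ M F(u)` as `u → 0⁺` then `∑_{i ≤ n} G(h_i) ∼ β_{[1]} M n F(h_n)`. -/
lemma H4.tendsto_sum_div (h4 : H4 F h l α β) (hpos : ∀ n, 1 ≤ n → 0 < h n)
    (hF : ∀ t, 0 < t → 0 < F t) {G : ℝ → ℝ} {M : ℝ}
    (hG : Tendsto (fun u => G u / F u) (𝓝[>] 0) (𝓝 M)) :
    Tendsto (fun n : ℕ => (∑ i ∈ Finset.range n, G (h (i + 1))) / (n * F (h n))) atTop
      (𝓝 (β 1 * M)) := by
  have hFi : ∀ i, 0 < F (h (i + 1)) := fun i => hF _ (hpos _ (Nat.le_add_left 1 i))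
  refine (tendsto_sum_mul_div (fun i => (hFi i).le) h4.tendsto_nF h4.tendsto_sum_F_div
    (h4.beta_one_pos fun n hn => hF _ (hpos n hn)) (hG.comp (h4.tendsto_succ hpos))).congr
    fun n => ?_
  congr 1
  refine Finset.sum_congr rfl fun i _ => ?_
  simp only [Function.comp]
  rw [mul_div_cancel₀ _ (hFi i).ne']

/-- Terms of order `h_i F(h_i)` add up to `o(√(n F(h_n)))` when `h_n √(n F(h_n)) → 0`. -/
lemma H4.tendsto_sum_bias_div (h4 : H4 F h 0 α β) (hpos : ∀ n, 1 ≤ n → 0 < h n)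
    (hF : ∀ t, 0 < t → 0 < F t)
    (hbias : Tendsto (fun n : ℕ => h n * √((n : ℝ) * F (h n))) atTop (𝓝 0)) {b : ℝ → ℝ} {C : ℝ}
    (hb : ∀ᶠ u in 𝓝[>] 0, |b u| ≤ C * (u * F u)) :
    Tendsto (fun n : ℕ => (∑ i ∈ Finset.range n, b (h (i + 1))) / √(n * F (h n))) atTop
      (𝓝 0) := by
  have hw : ∀ i, 0 < h (i + 1) * F (h (i + 1)) := fun i =>
    mul_pos (hpos _ (Nat.le_add_left 1 i)) (hF _ (hpos _ (Nat.le_add_left 1 i)))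
  have hO : (fun i => b (h (i + 1))) =O[atTop] fun i => h (i + 1) * F (h (i + 1)) := by
    refine Asymptotics.IsBigO.of_bound C ?_
    filter_upwards [(h4.tendsto_succ hpos).eventually hb] with i hi
    rwa [Real.norm_of_nonneg (hw i).le]
  obtain ⟨C', -, hC'⟩ := Asymptotics.bound_of_isBigO_nat_atTop hO
  have hlim := (h4.tendsto_A.mul hbias).const_mul C'
  rw [mul_zero, mul_zero] at hlim
  refine squeeze_zero_norm' ?_ hlim
  filter_upwards [eventually_ge_atTop 1] with n hn
  have hn0 : (0 : ℝ) < n := Nat.cast_pos.2 hn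
  have hFn : 0 < F (h n) := hF _ (hpos n hn)
  have hhn := hpos n hn
  have hN : 0 < (n : ℝ) * F (h n) := mul_pos hn0 hFn
  have hsum : ‖∑ i ∈ Finset.range n, b (h (i + 1))‖ ≤
      C' * ∑ i ∈ Finset.range n, h (i + 1) * F (h (i + 1)) := by
    rw [Finset.mul_sum]
    refine norm_sum_le_of_le _ fun i _ => ?_
    have := hC' (hw i).ne'
    rwa [Real.norm_of_nonneg (hw i).le] at this
  have hA : 1 / (n : ℝ) * ∑ i ∈ Finset.Icc 1 n, h i / h n * (F (h i) / F (h n)) ^ (1 - (0 : ℝ)) =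
      (∑ i ∈ Finset.range n, h (i + 1) * F (h (i + 1))) / (n * F (h n) * h n) := by
    simp only [sub_zero, Real.rpow_one]
    rw [sum_Icc_one_eq_sum_range fun i => h i / h n * (F (h i) / F (h n)), Finset.sum_div,
      Finset.mul_sum]
    refine Finset.sum_congr rfl fun i _ => ?_
    field_simp
  rw [hA, norm_div, Real.norm_of_nonneg (Real.sqrt_nonneg _)]
  have hs : 0 < √((n : ℝ) * F (h n)) := Real.sqrt_pos.2 hN
  rw [div_le_iff₀ hs]
  refine hsum.trans (le_of_eq ?_)
  have h1 : √((n : ℝ) * F (h n)) * √((n : ℝ) * F (h n)) = n * F (h n) := Real.mul_self_sqrt hN.le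
  calc C' * ∑ i ∈ Finset.range n, h (i + 1) * F (h (i + 1))
      = C' * ((∑ i ∈ Finset.range n, h (i + 1) * F (h (i + 1))) / (n * F (h n) * h n) *
          (h n * (n * F (h n)))) := by field_simp
    _ = _ := by linear_combination (-(C' * ((∑ i ∈ Finset.range n, h (i + 1) * F (h (i + 1))) /
        (n * F (h n) * h n)) * h n)) * h1

end Bandwidths

/-! ### Limit theorems for sums over the sample -/

section Sample

variable {Ω E : Type*} [MeasurableSpace Ω] [MeasurableSpace E]
  {P : Measure Ω} {X : Ω → E} {Y : Ω → ℝ} {Xs : ℕ → Ω → E} {Ys : ℕ → Ω → ℝ}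

lemma IsSample.identDistrib_comp (hs : IsSample P X Y Xs Ys) (i : ℕ) {f : E × ℝ → ℝ}
    (hf : Measurable f) :
    IdentDistrib (fun ω => f (Xs (i + 1) ω, Ys (i + 1) ω)) (fun ω => f (X ω, Y ω)) P P :=
  (hs.identDistrib (i + 1) (Nat.le_add_left 1 i)).comp hf

/-- Weak law of large numbers for sums over the sample; the conditions are on the population. -/
lemma IsSample.tendstoInMeasure_sum [IsProbabilityMeasure P] (hs : IsSample P X Y Xs Ys)
    {f : ℕ → ℕ → E × ℝ → ℝ}
    (hf : ∀ n i, Measurable (f n i)) (hL2 : ∀ n i, MemLp (fun ω => f n i (X ω, Y ω)) 2 P) {c : ℝ}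
    (hmean : Tendsto (fun n => ∑ i ∈ Finset.range n, ∫ ω, f n i (X ω, Y ω) ∂P) atTop (𝓝 c))
    (hsq : Tendsto (fun n => ∑ i ∈ Finset.range n, ∫ ω, f n i (X ω, Y ω) ^ 2 ∂P) atTop (𝓝 0)) :
    TendstoInMeasure P (fun n ω => ∑ i ∈ Finset.range n, f n i (Xs (i + 1) ω, Ys (i + 1) ω)) atTop
      fun _ => c := by
  refine tendstoInMeasure_sum_of_second_moment (s := fun n => Finset.range n)
    (X := fun n i ω => f n i (Xs (i + 1) ω, Ys (i + 1) ω))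
    (fun n i => (hs.identDistrib_comp i (hf n i)).memLp_iff.2 (hL2 n i))
    (fun n => hs.indep.comp _ fun i => hf n i) ?_ ?_
  · simpa only [(hs.identDistrib_comp _ (hf _ _)).integral_eq] using hmean
  · simpa only [(hs.identDistrib_comp _ ((hf _ _).pow_const 2)).integral_eq] using hsq

/-- Lindeberg's theorem for sums over the sample; the conditions are on the population. -/
lemma IsSample.tendstoInDistribution_sum [IsProbabilityMeasure P] (hs : IsSample P X Y Xs Ys)
    {f : ℕ → ℕ → E × ℝ → ℝ}
    (hf : ∀ n i, Measurable (f n i)) (hL2 : ∀ n i, MemLp (fun ω => f n i (X ω, Y ω)) 2 P)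
    (h0 : ∀ n i, ∫ ω, f n i (X ω, Y ω) ∂P = 0)
    (hvar : Tendsto (fun n => ∑ i ∈ Finset.range n, ∫ ω, f n i (X ω, Y ω) ^ 2 ∂P) atTop (𝓝 1))
    (hL : ∀ η > 0, Tendsto (fun n => ∑ i ∈ Finset.range n,
      ∫ ω, {ω | η < |f n i (X ω, Y ω)|}.indicator (fun ω => f n i (X ω, Y ω) ^ 2) ω ∂P) atTop
      (𝓝 0)) :
    TendstoInDistribution (fun n ω => ∑ i ∈ Finset.range n, f n i (Xs (i + 1) ω, Ys (i + 1) ω))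
      atTop (id : ℝ → ℝ) (fun _ => P) (gaussianReal 0 1) := by
  refine tendstoInDistribution_sum_of_lindeberg (s := fun n => Finset.range n)
    (X := fun n i ω => f n i (Xs (i + 1) ω, Ys (i + 1) ω))
    (fun n i => (hs.identDistrib_comp i (hf n i)).memLp_iff.2 (hL2 n i))
    (fun n => hs.indep.comp _ fun i => hf n i) (fun n i => ?_) ?_ fun η hη => ?_
  · rw [(hs.identDistrib_comp i (hf n i)).integral_eq, h0]
  · simpa only [(hs.identDistrib_comp _ ((hf _ _).pow_const 2)).integral_eq] using hvar
  · have hg : ∀ n i, Measurable ({z | η < |f n i z|}.indicator fun z => f n i z ^ 2) := fun n i =>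
      ((hf n i).pow_const 2).indicator
        (measurableSet_lt measurable_const (continuous_abs.measurable.comp (hf n i)))
    have e : ∀ n i,
        ∫ ω, {ω | η < |f n i (Xs (i + 1) ω, Ys (i + 1) ω)|}.indicator
          (fun ω => f n i (Xs (i + 1) ω, Ys (i + 1) ω) ^ 2) ω ∂P =
        ∫ ω, {ω | η < |f n i (X ω, Y ω)|}.indicator (fun ω => f n i (X ω, Y ω) ^ 2) ω ∂P :=
      fun n i => (hs.identDistrib_comp i (hg n i)).integral_eq
    simpa only [e] using hL η hη

end Sample

/-! ### Consistency of the denominator and of the empirical small ball probabilities -/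

section Estimators

lemma empF_eq {Ω E : Type*} [AddCommGroup E] [Module ℝ E] {p : Seminorm ℝ E} {χ : E}
    {Xs : ℕ → Ω → E} (n : ℕ) (t : ℝ) (ω : Ω) : empF p χ Xs n t ω =
    1 / (n : ℝ) * ∑ j ∈ Finset.range n,
      {x : E | p (χ - x) ≤ t}.indicator (1 : E → ℝ) (Xs (j + 1) ω) := by
  rw [empF, sum_Icc_one_eq_sum_range
    fun i => {ω' : Ω | p (Xs i ω' - χ) ≤ t}.indicator (fun _ => (1 : ℝ)) ω]
  congr 1
  refine Finset.sum_congr rfl fun j _ => ?_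
  simp only [Set.indicator_apply, Set.mem_ofPred_eq, map_sub_rev p χ, Pi.one_apply]

lemma integral_indicator_ball {Ω E : Type*} [MeasurableSpace Ω] [AddCommGroup E] [Module ℝ E]
    [MeasurableSpace E] {P : Measure Ω} {p : Seminorm ℝ E} {χ : E} {X : Ω → E}
    (hp : Measurable fun x : E => p (χ - x)) (hX : Measurable X) (t : ℝ) :
    ∫ ω, {x : E | p (χ - x) ≤ t}.indicator (1 : E → ℝ) (X ω) ∂P =
      smallBall P p X χ t := by
  have hset : MeasurableSet {ω | p (χ - X ω) ≤ t} := measurable_semidist hp hX measurableSet_Iic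
  have : (fun ω => {x : E | p (χ - x) ≤ t}.indicator (1 : E → ℝ) (X ω)) =
      {ω | p (χ - X ω) ≤ t}.indicator 1 := rfl
  rw [this, integral_indicator_one hset]
  rfl

variable {Ω E : Type*} [MeasurableSpace Ω] [AddCommGroup E] [Module ℝ E] [MeasurableSpace E]
  {P : Measure Ω} [IsProbabilityMeasure P] {p : Seminorm ℝ E} {χ : E}
  {X : Ω → E} {Y : Ω → ℝ} {r sigmaSq : E → ℝ} {K τ₀ : ℝ → ℝ} {Xs : ℕ → Ω → E} {Ys : ℕ → Ω → ℝ}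
  {h : ℕ → ℝ} {α : ℝ} {β : ℝ → ℝ}

lemma memLp_kernel (hp : Measurable fun x : E => p (χ - x)) (hX : Measurable X) (h2 : H2 K)
    (u c : ℝ) {q : ENNReal} : MemLp (fun ω => K (p (χ - X ω) / u) / c) q P := by
  obtain ⟨C, hC⟩ := h2.bounded
  refine MemLp.of_bound ((h2.measurable.comp
    ((measurable_semidist hp hX).div_const u)).div_const c).aestronglyMeasurable (C / |c|)
    (ae_of_all _ fun ω => ?_)
  rw [norm_div, Real.norm_of_nonneg (h2.nonneg _), Real.norm_eq_abs]
  gcongr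
  exact hC _

/-- The normalised denominator of the estimator converges to `β_{[1]} M₁`. -/
lemma tendstoInMeasure_denominator (hs : IsSample P X Y Xs Ys)
    (hp : Measurable fun x : E => p (χ - x)) (hX : Measurable X) (hpos : ∀ n, 1 ≤ n → 0 < h n)
    (h2 : H2 K) (h3 : H3 (smallBall P p X χ) τ₀) (h4 : H4 (smallBall P p X χ) h 0 α β)
    (hF : ∀ t, 0 < t → 0 < smallBall P p X χ t) :
    TendstoInMeasure P (fun (n : ℕ) ω => (∑ i ∈ Finset.range n,
      K (p (χ - Xs (i + 1) ω) / h (i + 1))) / (n * smallBall P p X χ (h n))) atTop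
      fun _ => β 1 * M1 K τ₀ := by
  have hmain := hs.tendstoInMeasure_sum
    (f := fun n i z => K (p (χ - z.1) / h (i + 1)) / (n * smallBall P p X χ (h n)))
    (c := β 1 * M1 K τ₀)
    (fun n i => (h2.measurable.comp ((hp.comp measurable_fst).div_const _)).div_const _)
    (fun n i => memLp_kernel hp hX h2 _ _) ?_ ?_
  · simpa only [Finset.sum_div] using hmain
  · simp only [integral_div, ← Finset.sum_div]
    exact h4.tendsto_sum_div hpos hF (tendsto_integral_K_div hp hX h2 h3 hF)
  · have h1 := (h4.tendsto_sum_div hpos hF (tendsto_integral_K_sq_div hp hX h2 h3 hF)).div_atTop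
      h4.tendsto_nF
    refine h1.congr fun n => ?_
    simp only [div_pow, integral_div, ← Finset.sum_div]
    rw [div_div, ← sq]

/-- Averages of `F̂` over finitely many radii `t n i` concentrate around their mean, at the scale of
`F(h_n)`: they are sums over the sample of a function with values in `[0,1]`, whose second moment is
at most its mean. -/
lemma tendstoInMeasure_average_empF (hs : IsSample P X Y Xs Ys)
    (hp : Measurable fun x : E => p (χ - x)) (hX : Measurable X)
    (hN : Tendsto (fun n : ℕ => (n : ℝ) * smallBall P p X χ (h n)) atTop atTop)
    {ι : Type*} {s : ℕ → Finset ι} {t : ℕ → ι → ℝ} {a : ℕ → ℝ} (ha : ∀ n, 0 ≤ a n)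
    (hsa : ∀ n, a n * (s n).card ≤ 1) {c : ℝ}
    (hc : Tendsto (fun n => a n * (∑ i ∈ s n, smallBall P p X χ (t n i)) /
      smallBall P p X χ (h n)) atTop (𝓝 c)) :
    TendstoInMeasure P (fun n ω => a n * (∑ i ∈ s n, empF p χ Xs n (t n i) ω) /
      smallBall P p X χ (h n)) atTop fun _ => c := by
  -- `G n` is the average of the indicators as a function of the covariate; `0 ≤ G n ≤ 1`
  set G : ℕ → E → ℝ := fun n x =>
    a n * ∑ i ∈ s n, {x : E | p (χ - x) ≤ t n i}.indicator (1 : E → ℝ) x with hG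
  have hGm : ∀ n, Measurable (G n) := fun n =>
    (Finset.measurable_fun_sum _ fun i _ => (measurable_const.indicator
      (hp measurableSet_Iic))).const_mul _
  have hG0 : ∀ n x, 0 ≤ G n x := fun n x => mul_nonneg (ha n) (Finset.sum_nonneg fun i _ =>
    Set.indicator_nonneg (fun _ _ => zero_le_one) _)
  have hG1 : ∀ n x, G n x ≤ 1 := fun n x => by
    refine le_trans (mul_le_mul_of_nonneg_left (Finset.sum_le_card_nsmul _ _ 1 fun i _ =>
      Set.indicator_le_self' (fun _ _ => zero_le_one) x) (ha n)) ?_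
    simpa using hsa n
  have hGi : ∀ n, Integrable (fun ω => G n (X ω)) P := fun n =>
    Integrable.of_bound ((hGm n).comp hX).aestronglyMeasurable 1 (ae_of_all _ fun ω => by
      rw [Real.norm_of_nonneg (hG0 _ _)]; exact hG1 _ _)
  have hGint : ∀ n, ∫ ω, G n (X ω) ∂P = a n * ∑ i ∈ s n, smallBall P p X χ (t n i) := fun n => by
    simp only [hG]
    rw [integral_const_mul, integral_finsetSum]
    · simp only [integral_indicator_ball hp hX]
    · intro i _
      exact (integrable_const (1 : ℝ)).indicator (measurable_semidist hp hX measurableSet_Iic)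
  have hmain := hs.tendstoInMeasure_sum
    (f := fun n _ z => G n z.1 / (n * smallBall P p X χ (h n))) (c := c)
    (fun n i => ((hGm n).comp measurable_fst).div_const _)
    (fun n i => MemLp.of_bound (((hGm n).comp hX).div_const _).aestronglyMeasurable
      (1 / |n * smallBall P p X χ (h n)|) (ae_of_all _ fun ω => ?_)) ?_ ?_
  · refine TendstoInMeasure.congr_left (fun n => ae_of_all _ fun ω => ?_) hmain
    simp only [empF_eq, hG]
    rw [← Finset.sum_div, ← Finset.mul_sum, ← Finset.mul_sum, Finset.sum_comm,
      one_div, mul_left_comm, mul_comm (n : ℝ), ← div_div, div_right_comm,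
      div_eq_inv_mul _ (n : ℝ)]
  · rw [norm_div, Real.norm_of_nonneg (hG0 _ _), Real.norm_eq_abs]
    gcongr
    exact hG1 _ _
  · refine hc.congr' ?_
    filter_upwards [eventually_gt_atTop 0] with n hn
    have hn0 : (n : ℝ) ≠ 0 := (Nat.cast_pos.2 hn).ne'
    simp only [integral_div, hGint, Finset.sum_const, Finset.card_range, nsmul_eq_mul]
    field_simp
  · have hup := hc.div_atTop hN
    refine squeeze_zero' (Eventually.of_forall fun n => Finset.sum_nonneg fun i _ =>
      integral_nonneg fun _ => sq_nonneg _) ?_ hup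
    filter_upwards [eventually_gt_atTop 0, hN.eventually_gt_atTop 0] with n hn hNn
    have hn0 : (0 : ℝ) < n := Nat.cast_pos.2 hn
    have hF0 : 0 < smallBall P p X χ (h n) := pos_of_mul_pos_right hNn hn0.le
    have hle : ∫ ω, G n (X ω) ^ 2 ∂P ≤ a n * ∑ i ∈ s n, smallBall P p X χ (t n i) := by
      rw [← hGint]
      refine integral_mono_of_nonneg (ae_of_all _ fun _ => sq_nonneg _) (hGi n)
        (ae_of_all _ fun ω => ?_)
      have := mul_le_mul_of_nonneg_left (hG1 n (X ω)) (hG0 n (X ω))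
      simp only
      nlinarith
    simp only [div_pow, integral_div, Finset.sum_const, Finset.card_range, nsmul_eq_mul]
    calc (n : ℝ) * ((∫ ω, G n (X ω) ^ 2 ∂P) / (n * smallBall P p X χ (h n)) ^ 2)
        ≤ n * ((a n * ∑ i ∈ s n, smallBall P p X χ (t n i)) /
          (n * smallBall P p X χ (h n)) ^ 2) := by gcongr
      _ = _ := by field_simp

/-- The empirical small ball probability is equivalent to `F(h_n)`. -/
lemma tendstoInMeasure_empF_div (hs : IsSample P X Y Xs Ys)
    (hp : Measurable fun x : E => p (χ - x)) (hX : Measurable X)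
    (hN : Tendsto (fun n : ℕ => (n : ℝ) * smallBall P p X χ (h n)) atTop atTop) :
    TendstoInMeasure P (fun n ω => empF p χ Xs n (h n) ω / smallBall P p X χ (h n)) atTop
      fun _ => 1 := by
  have := tendstoInMeasure_average_empF hs hp hX hN (ι := Unit) (s := fun _ => {()})
    (t := fun n _ => h n) (a := fun _ => 1) (c := 1) (fun _ => zero_le_one) (fun _ => by simp) ?_
  · simpa using this
  · refine tendsto_const_nhds.congr' ?_
    filter_upwards [hN.eventually_gt_atTop 0] with n hn
    have hF0 : smallBall P p X χ (h n) ≠ 0 := (pos_of_mul_pos_right hn n.cast_nonneg).ne'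
    simp [hF0]

lemma tendstoInMeasure_empBeta_num (hs : IsSample P X Y Xs Ys)
    (hp : Measurable fun x : E => p (χ - x)) (hX : Measurable X)
    (h4 : H4 (smallBall P p X χ) h 0 α β) :
    TendstoInMeasure P (fun (n : ℕ) ω =>
      1 / (n : ℝ) * (∑ i ∈ Finset.Icc 1 n, empF p χ Xs n (h i) ω) /
        smallBall P p X χ (h n)) atTop fun _ => β 1 := by
  refine tendstoInMeasure_average_empF hs hp hX h4.tendsto_nF (s := fun n => Finset.Icc 1 n)
    (t := fun _ i => h i) (a := fun n => 1 / (n : ℝ)) (fun n => by positivity) (fun n => ?_) ?_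
  · rcases Nat.eq_zero_or_pos n with rfl | hn
    · simp
    · have : (n : ℝ) ≠ 0 := (Nat.cast_pos.2 hn).ne'
      simp [this]
  · refine h4.tendsto_sum_F_div.congr fun n => ?_
    rw [sum_Icc_one_eq_sum_range fun i => smallBall P p X χ (h i), one_div_mul_eq_div, div_div]

/-- Consistency of `β̂_{[1]}`. -/
lemma tendstoInMeasure_empBeta (hs : IsSample P X Y Xs Ys)
    (hp : Measurable fun x : E => p (χ - x)) (hX : Measurable X)
    (h4 : H4 (smallBall P p X χ) h 0 α β) :
    TendstoInMeasure P (fun n ω => empBeta p χ h Xs n ω) atTop fun _ => β 1 := by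
  have hdiv := tendstoInMeasure_comp₂_of_continuousAt (tendstoInMeasure_empBeta_num hs hp hX h4)
    (tendstoInMeasure_empF_div hs hp hX h4.tendsto_nF) (φ := fun q => q.1 / q.2)
    (continuousAt_fst.div continuousAt_snd one_ne_zero)
  refine TendstoInMeasure.congr' ?_ (by simp) hdiv
  filter_upwards [h4.tendsto_nF.eventually_gt_atTop 0] with n hn
  have hF0 : smallBall P p X χ (h n) ≠ 0 := (pos_of_mul_pos_right hn n.cast_nonneg).ne'
  refine ae_of_all _ fun ω => ?_
  simp only [empBeta, ← Finset.sum_div]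
  rw [div_div_div_cancel_right₀ hF0, mul_div_assoc]

end Estimators

/-! ### Measurability of the estimators -/

section Measurability

lemma recEstimator_zero_eq {Ω E : Type*} [AddCommGroup E] [Module ℝ E] {p : Seminorm ℝ E} {χ : E}
    {K : ℝ → ℝ} {h : ℕ → ℝ} {Xs : ℕ → Ω → E} {Ys : ℕ → Ω → ℝ} (F : ℝ → ℝ) (n : ℕ) (ω : Ω) :
    recEstimator p χ F K h 0 Xs Ys n ω =
      (∑ i ∈ Finset.range n, Ys (i + 1) ω * K (p (χ - Xs (i + 1) ω) / h (i + 1))) /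
        ∑ i ∈ Finset.range n, K (p (χ - Xs (i + 1) ω) / h (i + 1)) := by
  simp only [recEstimator, Real.rpow_zero, div_one, one_mul]
  rw [sum_Icc_one_eq_sum_range fun i => Ys i ω * K (p (χ - Xs i ω) / h i),
    sum_Icc_one_eq_sum_range fun i => K (p (χ - Xs i ω) / h i)]

variable {Ω E : Type*} [MeasurableSpace Ω] [AddCommGroup E] [Module ℝ E] [MeasurableSpace E]
  {P : Measure Ω} {p : Seminorm ℝ E} {χ : E}
  {X : Ω → E} {Y : Ω → ℝ} {r : E → ℝ} {K : ℝ → ℝ} {Xs : ℕ → Ω → E} {Ys : ℕ → Ω → ℝ}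
  {h : ℕ → ℝ}

lemma measurable_empF (hs : IsSample P X Y Xs Ys) (hp : Measurable fun x : E => p (χ - x))
    (n : ℕ) (t : ℝ) : Measurable (empF p χ Xs n t) := by
  have : empF p χ Xs n t = fun ω => 1 / (n : ℝ) * ∑ j ∈ Finset.range n,
      {x : E | p (χ - x) ≤ t}.indicator (1 : E → ℝ) (Xs (j + 1) ω) := funext (empF_eq n t)
  rw [this]
  exact (Finset.measurable_fun_sum _ fun j _ => (measurable_one.indicator
    (hp measurableSet_Iic)).comp (hs.measurable_Xs _ (Nat.le_add_left 1 j))).const_mul _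

lemma measurable_empBeta (hs : IsSample P X Y Xs Ys) (hp : Measurable fun x : E => p (χ - x))
    (n : ℕ) : Measurable (empBeta p χ h Xs n) :=
  (Finset.measurable_fun_sum _ fun _ _ =>
    (measurable_empF hs hp n _).div (measurable_empF hs hp n _)).const_mul _

lemma aemeasurable_studentized (hs : IsSample P X Y Xs Ys)
    (hp : Measurable fun x : E => p (χ - x)) (h2 : H2 K) (F : ℝ → ℝ)
    {M1hat M2hat sigmaHat : ℕ → Ω → ℝ} (n : ℕ) (hM1 : AEMeasurable (M1hat n) P)
    (hM2 : AEMeasurable (M2hat n) P) (hσ : AEMeasurable (sigmaHat n) P) :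
    AEMeasurable (studentized p χ F K h r Xs Ys M1hat M2hat sigmaHat n) P := by
  have hK : ∀ i, Measurable fun ω => K (p (χ - Xs (i + 1) ω) / h (i + 1)) := fun i =>
    h2.measurable.comp ((hp.comp (hs.measurable_Xs _ (Nat.le_add_left 1 i))).div_const _)
  have hrec : Measurable (recEstimator p χ F K h 0 Xs Ys n) := by
    rw [funext (recEstimator_zero_eq F n)]
    exact (Finset.measurable_fun_sum _ fun i _ =>
      (hs.measurable_Ys _ (Nat.le_add_left 1 i)).mul (hK i)).div
      (Finset.measurable_fun_sum _ fun i _ => hK i)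
  have h1 : AEMeasurable (fun ω => √((n : ℝ) * empF p χ Xs n (h n) ω)) P :=
    ((measurable_empF hs hp n _).const_mul _).sqrt.aemeasurable
  have h3 : AEMeasurable (fun ω =>
      √(empBeta p χ h Xs n ω * M1hat n ω ^ 2 / (M2hat n ω * sigmaHat n ω ^ 2))) P :=
    (((measurable_empBeta hs hp n).aemeasurable.mul (hM1.pow_const 2)).div
      (hM2.mul (hσ.pow_const 2))).sqrt
  exact (h1.mul h3).mul (hrec.sub_const _).aemeasurable

end Measurability

/-! ### The numerator of the estimator -/

section Limit

variable {Ω E : Type*} [MeasurableSpace Ω] [AddCommGroup E] [Module ℝ E] [MeasurableSpace E]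
  {P : Measure Ω} {p : Seminorm ℝ E} {χ : E}
  {X : Ω → E} {Y : Ω → ℝ} {r sigmaSq : E → ℝ} {K τ₀ : ℝ → ℝ} {Xs : ℕ → Ω → E} {Ys : ℕ → Ω → ℝ}
  {h : ℕ → ℝ} {α : ℝ} {β : ℝ → ℝ}

/-- The Lindeberg condition for the errors, from the exponential moment of `Y`: near `χ` the
error is at most `|Y| + c`, and only finitely many bandwidths are not small. -/
lemma tendsto_lindeberg_eps (hm : IsRegressionModel P X Y r sigmaSq) (hpos : ∀ n, 1 ≤ n → 0 < h n)
    (hr : ContinuousNear p r χ) (h2 : H2 K) (hh : Tendsto h atTop (𝓝 0)) (h5 : H5 P Y)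
    {s : ℕ → ℝ} (hs : Tendsto s atTop atTop)
    (hlog : ∀ δ : ℝ, 0 < δ → Tendsto (fun n : ℕ => Real.log n ^ δ / s n) atTop (𝓝 0))
    {η : ℝ} (hη : 0 < η) :
    Tendsto (fun n => ∑ i ∈ Finset.range n,
      ∫ ω, {ω | η < |(Y ω - r (X ω)) * K (p (χ - X ω) / h (i + 1)) / s n|}.indicator
        (fun ω => ((Y ω - r (X ω)) * K (p (χ - X ω) / h (i + 1)) / s n) ^ 2) ω ∂P) atTop
      (𝓝 0) := by
  obtain ⟨C, hC0, hC⟩ := h2.exists_bound_pos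
  obtain ⟨ρ, hρ, hrρ⟩ := hr.exists_lt 1 one_pos
  set c : ℝ := |r χ| + 1 with hc
  have hc0 : 0 < c := by positivity
  have hrc : ∀ x, p (χ - x) < ρ → |r x| ≤ c := fun x hx => by
    have h1 := hrρ x hx
    have h2 := abs_sub_abs_le_abs_sub (r x) (r χ)
    linarith
  obtain ⟨i₀, hi₀⟩ := eventually_atTop.1
    (((tendsto_add_atTop_iff_nat 1).2 hh).eventually (gt_mem_nhds hρ))
  -- once `κ s n ≥ c`, an error term above `η s n` forces `|Y| > κ s n ≥ c`, so `|Y| + c ≤ 2 |Y|`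
  set κ : ℝ := η / (2 * C) with hκ
  have hκ0 : 0 < κ := by positivity
  set q : ℕ → ℝ := fun n => ∫ ω, {ω | κ * s n < |Y ω|}.indicator (fun ω => Y ω ^ 2) ω ∂P with hq
  have hq0 : ∀ n, 0 ≤ q n := fun n =>
    integral_nonneg fun _ => Set.indicator_nonneg (fun _ _ => sq_nonneg _) _
  set A : ℝ := C ^ 2 * ∫ ω, (Y ω - r (X ω)) ^ 2 ∂P with hA
  have hA0 : 0 ≤ A := mul_nonneg (sq_nonneg _) (integral_nonneg fun _ => sq_nonneg _)
  have hs2 : Tendsto (fun n => s n ^ 2) atTop atTop := (tendsto_pow_atTop two_ne_zero).comp hs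
  have hup : Tendsto (fun n : ℕ => i₀ * A / s n ^ 2 + 4 * C ^ 2 * (n * q n) / s n ^ 2) atTop
      (𝓝 0) := by
    have h1 : Tendsto (fun n : ℕ => i₀ * A / s n ^ 2) atTop (𝓝 0) :=
      tendsto_const_nhds.div_atTop hs2
    have h2 := ((h5.tendsto_truncated hs hlog hκ0).const_mul (4 * C ^ 2)).div_atTop hs2
    simpa using h1.add h2
  have hY2 : Integrable (fun ω => Y ω ^ 2) P := (h5.memLp_two hm.measurable_Y).integrable_sq
  refine squeeze_zero' (Eventually.of_forall fun n => Finset.sum_nonneg fun i _ =>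
    integral_nonneg fun _ => Set.indicator_nonneg (fun _ _ => sq_nonneg _) _) ?_ hup
  filter_upwards [hs.eventually_gt_atTop 0, hs.eventually_ge_atTop (c / κ)] with n hs0 hsc
  rw [div_le_iff₀' hκ0] at hsc
  have hterm : ∀ i ∈ Finset.range n,
      ∫ ω, {ω | η < |(Y ω - r (X ω)) * K (p (χ - X ω) / h (i + 1)) / s n|}.indicator
        (fun ω => ((Y ω - r (X ω)) * K (p (χ - X ω) / h (i + 1)) / s n) ^ 2) ω ∂P ≤
      (if i < i₀ then A / s n ^ 2 else 0) + 4 * C ^ 2 * q n / s n ^ 2 := by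
    intro i _
    have hnn : 0 ≤ 4 * C ^ 2 * q n / s n ^ 2 := by have := hq0 n; positivity
    by_cases hi : i < i₀
    · rw [if_pos hi]
      refine le_trans ?_ (le_add_of_nonneg_right hnn)
      have e : A / s n ^ 2 = ∫ ω, C ^ 2 / s n ^ 2 * (Y ω - r (X ω)) ^ 2 ∂P := by
        rw [integral_const_mul, hA]; ring
      rw [e]
      refine integral_mono_of_nonneg
        (ae_of_all _ fun _ => Set.indicator_nonneg (fun _ _ => sq_nonneg _) _)
        (hm.integrable_sq.const_mul _) (ae_of_all _ fun ω => ?_)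
      refine (Set.indicator_le_self' (fun _ _ => sq_nonneg _) ω).trans ?_
      have h1 : K (p (χ - X ω) / h (i + 1)) ^ 2 ≤ C ^ 2 :=
        pow_le_pow_left₀ (h2.nonneg _) (hC _) 2
      simp only [div_pow, mul_pow]
      rw [div_mul_eq_mul_div, mul_comm (C ^ 2)]
      gcongr
    · rw [if_neg hi, zero_add]
      have e : 4 * C ^ 2 * q n / s n ^ 2 = ∫ ω, 4 * C ^ 2 / s n ^ 2 *
          {ω | κ * s n < |Y ω|}.indicator (fun ω => Y ω ^ 2) ω ∂P := by
        rw [integral_const_mul, hq]; ring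
      rw [e]
      have hset : MeasurableSet {ω | κ * s n < |Y ω|} :=
        measurableSet_lt measurable_const (continuous_abs.measurable.comp hm.measurable_Y)
      refine integral_mono_of_nonneg
        (ae_of_all _ fun _ => Set.indicator_nonneg (fun _ _ => sq_nonneg _) _)
        ((hY2.indicator hset).const_mul _) (ae_of_all _ fun ω => ?_)
      simp only
      by_cases hω : η < |(Y ω - r (X ω)) * K (p (χ - X ω) / h (i + 1)) / s n|
      · rw [Set.indicator_of_mem (by exact hω)]
        have hlt : p (χ - X ω) < ρ := by
          by_contra hge
          have hh1 : h (i + 1) < ρ := hi₀ i (not_lt.1 hi)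
          have hh0 : 0 < h (i + 1) := hpos _ (Nat.le_add_left 1 i)
          have hK : K (p (χ - X ω) / h (i + 1)) = 0 := h2.support _ fun hmem =>
            absurd ((div_le_one hh0).1 hmem.2) (not_le.2 (hh1.trans_le (not_lt.1 hge)))
          rw [hK] at hω
          simp only [mul_zero, zero_div, abs_zero] at hω
          linarith
        have hbd : |(Y ω - r (X ω)) * K (p (χ - X ω) / h (i + 1))| ≤ (|Y ω| + c) * C := by
          rw [abs_mul, abs_of_nonneg (h2.nonneg _)]
          refine mul_le_mul ((abs_sub _ _).trans ?_) (hC _) (h2.nonneg _) (by positivity)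
          exact add_le_add_right (hrc _ hlt) _
        rw [abs_div, abs_of_pos hs0, lt_div_iff₀ hs0] at hω
        have hκC : η = 2 * κ * C := by rw [hκ]; field_simp
        have h3 : 2 * κ * s n < |Y ω| + c := by
          have : (2 * κ * s n) * C < (|Y ω| + c) * C := by
            calc (2 * κ * s n) * C = η * s n := by rw [hκC]; ring
              _ < _ := hω.trans_le hbd
          exact lt_of_mul_lt_mul_right this hC0.le
        have h4 : κ * s n < |Y ω| := by linarith
        rw [Set.indicator_of_mem (by exact h4)]
        have h5 : |(Y ω - r (X ω)) * K (p (χ - X ω) / h (i + 1))| ≤ 2 * |Y ω| * C :=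
          hbd.trans (mul_le_mul_of_nonneg_right (by linarith) hC0.le)
        rw [div_pow, ← sq_abs, div_mul_eq_mul_div]
        refine div_le_div_of_nonneg_right ?_ (sq_nonneg _)
        calc _ ≤ (2 * |Y ω| * C) ^ 2 := pow_le_pow_left₀ (abs_nonneg _) h5 2
          _ = 4 * C ^ 2 * Y ω ^ 2 := by rw [mul_pow, mul_pow, sq_abs]; ring
      · rw [Set.indicator_of_notMem (by exact hω)]
        exact mul_nonneg (by positivity) (Set.indicator_nonneg (fun _ _ => sq_nonneg _) _)
  refine (Finset.sum_le_sum hterm).trans ?_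
  rw [Finset.sum_add_distrib, ← Finset.sum_filter, Finset.sum_const, Finset.sum_const,
    Finset.card_range, nsmul_eq_mul, nsmul_eq_mul]
  have hcard : (((Finset.range n).filter (· < i₀)).card : ℝ) ≤ i₀ := by
    have : (Finset.range n).filter (· < i₀) ⊆ Finset.range i₀ := fun i hi =>
      Finset.mem_range.2 (Finset.mem_filter.1 hi).2
    exact_mod_cast (Finset.card_le_card this).trans_eq (Finset.card_range i₀)
  have h1 := mul_le_mul_of_nonneg_right hcard (div_nonneg hA0 (sq_nonneg (s n)))
  refine (add_le_add_left h1 _).trans (le_of_eq ?_)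
  ring

variable [IsProbabilityMeasure P]

lemma memLp_mul_kernel (hp : Measurable fun x : E => p (χ - x)) (hX : Measurable X) (h2 : H2 K)
    {w : Ω → ℝ} (hw : MemLp w 2 P) (u c : ℝ) :
    MemLp (fun ω => w ω * K (p (χ - X ω) / u) / c) 2 P := by
  have h := MemLp.mul (p := ⊤) (q := 2) (r := 2) hw
    (memLp_kernel (P := P) (K := K) hp hX h2 u c)
  refine h.ae_eq (ae_of_all _ fun ω => ?_)
  simp only [Pi.mul_apply]
  ring

/-- The part of the numerator that is due to the variation of the regression function is
negligible at the scale `√(V n F(h_n))`. -/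
lemma tendstoInMeasure_bias (hm : IsRegressionModel P X Y r sigmaSq) (hs : IsSample P X Y Xs Ys)
    (hp : Measurable fun x : E => p (χ - x)) (hpos : ∀ n, 1 ≤ n → 0 < h n)
    (h1 : H1 P p X r sigmaSq χ) (h2 : H2 K) (h3 : H3 (smallBall P p X χ) τ₀)
    (h4 : H4 (smallBall P p X χ) h 0 α β) (h5 : H5 P Y)
    (hF : ∀ t, 0 < t → 0 < smallBall P p X χ t)
    (hbias : Tendsto (fun n : ℕ => h n * √((n : ℝ) * smallBall P p X χ (h n))) atTop (𝓝 0))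
    {V : ℝ} (hV : 0 < V) :
    TendstoInMeasure P (fun (n : ℕ) ω => ∑ i ∈ Finset.range n,
      (r (Xs (i + 1) ω) - r χ) * K (p (χ - Xs (i + 1) ω) / h (i + 1)) /
        √(V * (n * smallBall P p X χ (h n)))) atTop fun _ => 0 := by
  refine hs.tendstoInMeasure_sum
    (f := fun n i z => (r z.1 - r χ) * K (p (χ - z.1) / h (i + 1)) /
      √(V * (n * smallBall P p X χ (h n))))
    (fun n i => (((hm.measurable_r.comp measurable_fst).sub_const _).mul
      (h2.measurable.comp ((hp.comp measurable_fst).div_const _))).div_const _)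
    (fun n i => memLp_mul_kernel hp hm.measurable_X h2
      ((hm.memLp_r h5).sub (memLp_const _)) _ _) ?_ ?_
  · obtain ⟨C, hC⟩ := exists_integral_bias_le hm hp h1 h2 hF
    have hlim := (h4.tendsto_sum_bias_div hpos hF hbias hC).div_const (√V)
    rw [zero_div] at hlim
    refine hlim.congr fun n => ?_
    simp only [integral_div, ← Finset.sum_div]
    rw [div_div, ← Real.sqrt_mul' _ hV.le, mul_comm V]
  · have hlim := (h4.tendsto_sum_div hpos hF
      (tendsto_integral_bias_sq_div hm h5 hp h1.continuous_r h2 h3 hF)).div_const V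
    rw [mul_zero, zero_div] at hlim
    refine hlim.congr' ?_
    filter_upwards [h4.tendsto_nF.eventually_gt_atTop 0] with n hn
    simp only [div_pow, mul_pow, integral_div, ← Finset.sum_div]
    rw [Real.sq_sqrt (mul_pos hV hn).le, div_div, mul_comm V]

/-- Asymptotic normality of the error part of the numerator. -/
lemma tendstoInDistribution_eps (hm : IsRegressionModel P X Y r sigmaSq)
    (hs : IsSample P X Y Xs Ys)
    (hp : Measurable fun x : E => p (χ - x)) (hpos : ∀ n, 1 ≤ n → 0 < h n)
    (h1 : H1 P p X r sigmaSq χ) (h2 : H2 K) (h3 : H3 (smallBall P p X χ) τ₀)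
    (h4 : H4 (smallBall P p X χ) h 0 α β) (h5 : H5 P Y) (h7 : H7 (smallBall P p X χ) h)
    (hF : ∀ t, 0 < t → 0 < smallBall P p X χ t)
    {V : ℝ} (hV : 0 < V) (hVeq : V = β 1 * (sigmaSq χ * M2 K τ₀)) :
    TendstoInDistribution (fun (n : ℕ) ω => ∑ i ∈ Finset.range n,
      (Ys (i + 1) ω - r (Xs (i + 1) ω)) * K (p (χ - Xs (i + 1) ω) / h (i + 1)) /
        √(V * (n * smallBall P p X χ (h n)))) atTop (id : ℝ → ℝ) (fun _ => P)
      (gaussianReal 0 1) := by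
  obtain ⟨C, hC⟩ := h2.bounded
  have hsN : Tendsto (fun n : ℕ => √(V * (n * smallBall P p X χ (h n)))) atTop atTop :=
    Real.tendsto_sqrt_atTop.comp (h4.tendsto_nF.const_mul_atTop hV)
  refine hs.tendstoInDistribution_sum
    (f := fun n i z => (z.2 - r z.1) * K (p (χ - z.1) / h (i + 1)) /
      √(V * (n * smallBall P p X χ (h n))))
    (fun n i => ((measurable_snd.sub (hm.measurable_r.comp measurable_fst)).mul
      (h2.measurable.comp ((hp.comp measurable_fst).div_const _))).div_const _)
    (fun n i => memLp_mul_kernel hp hm.measurable_X h2 hm.memLp_eps _ _) (fun n i => ?_) ?_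
    fun η hη => ?_
  · rw [integral_div, hm.integral_eps_mul (g := fun x => K (p (χ - x) / h (i + 1)))
      (h2.measurable.comp (hp.div_const _)) (C := C) fun x => ?_, zero_div]
    rw [Real.norm_of_nonneg (h2.nonneg _)]
    exact hC _
  · have hlim := (h4.tendsto_sum_div hpos hF
      (tendsto_integral_eps_sq_div hm hp h1.continuous_sigmaSq h2 h3 hF)).div_const V
    rw [← hVeq, div_self hV.ne'] at hlim
    refine hlim.congr' ?_
    filter_upwards [h4.tendsto_nF.eventually_gt_atTop 0] with n hn
    simp only [div_pow, mul_pow, integral_div, ← Finset.sum_div]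
    rw [Real.sq_sqrt (mul_pos hV hn).le, div_div, mul_comm V]
  · refine tendsto_lindeberg_eps hm hpos h1.continuous_r h2 h4.tendsto_h h5 hsN
      (fun δ hδ => ?_) hη
    have := (h7 δ hδ).div_const (√V)
    rw [zero_div] at this
    refine this.congr fun n => ?_
    rw [div_div, ← Real.sqrt_mul' _ hV.le, mul_comm V]

/-- The normalised numerator of `r_n^{[0]}(χ) - r(χ)` is asymptotically standard normal. -/
lemma tendstoInDistribution_numerator (hm : IsRegressionModel P X Y r sigmaSq)
    (hs : IsSample P X Y Xs Ys)
    (hp : Measurable fun x : E => p (χ - x)) (hpos : ∀ n, 1 ≤ n → 0 < h n)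
    (h1 : H1 P p X r sigmaSq χ) (h2 : H2 K) (h3 : H3 (smallBall P p X χ) τ₀)
    (h4 : H4 (smallBall P p X χ) h 0 α β) (h5 : H5 P Y) (h7 : H7 (smallBall P p X χ) h)
    (hF : ∀ t, 0 < t → 0 < smallBall P p X χ t)
    (hbias : Tendsto (fun n : ℕ => h n * √((n : ℝ) * smallBall P p X χ (h n))) atTop (𝓝 0))
    {V : ℝ} (hV : 0 < V) (hVeq : V = β 1 * (sigmaSq χ * M2 K τ₀)) :
    TendstoInDistribution (fun (n : ℕ) ω => (∑ i ∈ Finset.range n,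
      (Ys (i + 1) ω - r χ) * K (p (χ - Xs (i + 1) ω) / h (i + 1))) /
        √(V * (n * smallBall P p X χ (h n)))) atTop (id : ℝ → ℝ) (fun _ => P)
      (gaussianReal 0 1) := by
  have hD : ∀ i, Measurable fun ω => p (χ - Xs (i + 1) ω) := fun i =>
    hp.comp (hs.measurable_Xs _ (Nat.le_add_left 1 i))
  have hb : ∀ n : ℕ, AEMeasurable (fun ω => ∑ i ∈ Finset.range n,
      (r (Xs (i + 1) ω) - r χ) * K (p (χ - Xs (i + 1) ω) / h (i + 1)) /
        √(V * (n * smallBall P p X χ (h n)))) P := fun n =>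
    (Finset.measurable_fun_sum _ fun i _ => ((((hm.measurable_r.comp (hs.measurable_Xs _
      (Nat.le_add_left 1 i))).sub_const _).mul
      (h2.measurable.comp ((hD i).div_const _))).div_const _)).aemeasurable
  have := (tendstoInDistribution_eps hm hs hp hpos h1 h2 h3 h4 h5 h7 hF hV
    hVeq).add_of_tendstoInMeasure_const
    (tendstoInMeasure_bias hm hs hp hpos h1 h2 h3 h4 h5 hF hbias hV) hb
  refine this.congr (fun n => ae_of_all _ fun ω => ?_) (ae_of_all _ fun ω => by simp)
  simp only [Pi.add_apply]
  rw [← Finset.sum_add_distrib, Finset.sum_div]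
  refine Finset.sum_congr rfl fun i _ => ?_
  ring

end Limit

/-! ### Studentization -/

section Studentization

lemma tendstoInMeasure_student_of_tendsto {Ω : Type*} [MeasurableSpace Ω] {P : Measure Ω}
    (V : ℝ) {f g k l m d : ℕ → Ω → ℝ} {f₀ g₀ k₀ l₀ m₀ d₀ : ℝ}
    (hf : TendstoInMeasure P f atTop fun _ => f₀) (hg : TendstoInMeasure P g atTop fun _ => g₀)
    (hk : TendstoInMeasure P k atTop fun _ => k₀) (hl : TendstoInMeasure P l atTop fun _ => l₀)
    (hm : TendstoInMeasure P m atTop fun _ => m₀) (hd : TendstoInMeasure P d atTop fun _ => d₀)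
    (hl₀ : l₀ ≠ 0) (hm₀ : m₀ ≠ 0) (hd₀ : d₀ ≠ 0) :
    TendstoInMeasure P (fun n ω => √V * √(f n ω) * √(g n ω * k n ω ^ 2 / (l n ω * m n ω ^ 2)) /
      d n ω) atTop fun _ => √V * √f₀ * √(g₀ * k₀ ^ 2 / (l₀ * m₀ ^ 2)) / d₀ := by
  have hratio := tendstoInMeasure_comp_of_continuousAt hf (g := fun x => √V * √x) (by fun_prop)
  have hM := tendstoInMeasure_comp₂_of_continuousAt hg hk (φ := fun q => q.1 * q.2 ^ 2)
    (by fun_prop)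
  have hS := tendstoInMeasure_comp₂_of_continuousAt hl hm (φ := fun q => q.1 * q.2 ^ 2)
    (by fun_prop)
  have hMS := tendstoInMeasure_comp₂_of_continuousAt hM hS (φ := fun q => √(q.1 / q.2))
    ((continuousAt_fst.div continuousAt_snd (mul_ne_zero hl₀ (pow_ne_zero 2 hm₀))).sqrt)
  have hprod := tendstoInMeasure_comp₂_of_continuousAt hratio hMS (φ := fun q => q.1 * q.2)
    (by fun_prop)
  exact tendstoInMeasure_comp₂_of_continuousAt hprod hd (φ := fun q => q.1 / q.2)
    (continuousAt_fst.div continuousAt_snd hd₀)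

variable {Ω E : Type*} [AddCommGroup E] [Module ℝ E]

/-- The numerator of `r_n^{[0]}(χ) - r(χ)`, normalised by `√(V n F(h_n))`. -/
noncomputable def normalizedNum (p : Seminorm ℝ E) (χ : E) (F K : ℝ → ℝ) (h : ℕ → ℝ) (r : E → ℝ)
    (V : ℝ) (Xs : ℕ → Ω → E) (Ys : ℕ → Ω → ℝ) (n : ℕ) (ω : Ω) : ℝ :=
  (∑ i ∈ Finset.range n, (Ys (i + 1) ω - r χ) * K (p (χ - Xs (i + 1) ω) / h (i + 1))) /
    √(V * (n * F (h n)))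

/-- The denominator of the estimator, normalised by `n F(h_n)`. -/
noncomputable def normalizedDen (p : Seminorm ℝ E) (χ : E) (F K : ℝ → ℝ) (h : ℕ → ℝ)
    (Xs : ℕ → Ω → E) (n : ℕ) (ω : Ω) : ℝ :=
  (∑ i ∈ Finset.range n, K (p (χ - Xs (i + 1) ω) / h (i + 1))) / (n * F (h n))

/-- The random factor by which the studentized statistic differs from the normalised numerator. -/
noncomputable def studentFactor (p : Seminorm ℝ E) (χ : E) (F K : ℝ → ℝ) (h : ℕ → ℝ) (V : ℝ)
    (Xs : ℕ → Ω → E) (M1hat M2hat sigmaHat : ℕ → Ω → ℝ) (n : ℕ) (ω : Ω) : ℝ :=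
  √V * √(empF p χ Xs n (h n) ω / F (h n)) *
    √(empBeta p χ h Xs n ω * M1hat n ω ^ 2 / (M2hat n ω * sigmaHat n ω ^ 2)) /
      normalizedDen p χ F K h Xs n ω

/-- Unless all kernel weights vanish, the studentized statistic is the product of the normalised
numerator with the studentizing factor. -/
lemma studentized_eq_mul (p : Seminorm ℝ E) (χ : E) (F K : ℝ → ℝ) (h : ℕ → ℝ) (r : E → ℝ)
    {V : ℝ} (hV : 0 < V) (Xs : ℕ → Ω → E) (Ys M1hat M2hat sigmaHat : ℕ → Ω → ℝ) {n : ℕ}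
    (hn : 0 < (n : ℝ) * F (h n)) {ω : Ω} (hne : normalizedDen p χ F K h Xs n ω ≠ 0) :
    studentized p χ F K h r Xs Ys M1hat M2hat sigmaHat n ω =
      normalizedNum p χ F K h r V Xs Ys n ω *
        studentFactor p χ F K h V Xs M1hat M2hat sigmaHat n ω := by
  have hFn : F (h n) ≠ 0 := (pos_of_mul_pos_right hn n.cast_nonneg).ne'
  have hS : ∑ i ∈ Finset.range n, K (p (χ - Xs (i + 1) ω) / h (i + 1)) =
      normalizedDen p χ F K h Xs n ω * (n * F (h n)) := (div_mul_cancel₀ _ hn.ne').symm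
  have hrec : recEstimator p χ F K h 0 Xs Ys n ω - r χ =
      normalizedNum p χ F K h r V Xs Ys n ω * √(V * (n * F (h n))) /
        (normalizedDen p χ F K h Xs n ω * (n * F (h n))) := by
    have hs : √(V * (n * F (h n))) ≠ 0 := (Real.sqrt_pos.2 (mul_pos hV hn)).ne'
    rw [recEstimator_zero_eq, normalizedNum]
    simp only [sub_mul, Finset.sum_sub_distrib, ← Finset.mul_sum]
    rw [hS, div_mul_cancel₀ _ hs, sub_div, mul_div_assoc (r χ),
      div_self (mul_ne_zero hne hn.ne'), mul_one]
  have hemp : √((n : ℝ) * empF p χ Xs n (h n) ω) =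
      √((n : ℝ) * F (h n)) * √(empF p χ Xs n (h n) ω / F (h n)) := by
    rw [← Real.sqrt_mul hn.le, mul_assoc, mul_div_cancel₀ _ hFn]
  have hsq : √((n : ℝ) * F (h n)) * √((n : ℝ) * F (h n)) = n * F (h n) := Real.mul_self_sqrt hn.le
  rw [studentized, hrec, hemp, Real.sqrt_mul hV.le]
  simp only [studentFactor]
  generalize normalizedNum p χ F K h r V Xs Ys n ω = T
  generalize normalizedDen p χ F K h Xs n ω = d at hne ⊢
  generalize √(empF p χ Xs n (h n) ω / F (h n)) = a
  generalize √(empBeta p χ h Xs n ω * M1hat n ω ^ 2 / (M2hat n ω * sigmaHat n ω ^ 2)) = b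
  generalize √V = v
  generalize √((n : ℝ) * F (h n)) = s at hsq ⊢
  rw [← hsq]
  have hs0 : s ≠ 0 := by
    rintro rfl
    rw [mul_zero] at hsq
    exact hn.ne hsq
  field_simp

variable [MeasurableSpace Ω] [MeasurableSpace E] {P : Measure Ω}
  {p : Seminorm ℝ E} {χ : E} {X : Ω → E} {Y : Ω → ℝ} {r sigmaSq : E → ℝ} {K τ₀ : ℝ → ℝ}
  {Xs : ℕ → Ω → E} {Ys : ℕ → Ω → ℝ} {h : ℕ → ℝ} {α : ℝ} {β : ℝ → ℝ}
  {M1hat M2hat sigmaHat : ℕ → Ω → ℝ}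

lemma measurable_normalizedDen (hs : IsSample P X Y Xs Ys)
    (hp : Measurable fun x : E => p (χ - x)) (h2 : H2 K) (F : ℝ → ℝ) (n : ℕ) :
    Measurable (normalizedDen p χ F K h Xs n) :=
  (Finset.measurable_fun_sum _ fun i _ => h2.measurable.comp ((hp.comp
    (hs.measurable_Xs _ (Nat.le_add_left 1 i))).div_const _)).div_const _

lemma aemeasurable_studentFactor (hs : IsSample P X Y Xs Ys)
    (hp : Measurable fun x : E => p (χ - x)) (h2 : H2 K) (F : ℝ → ℝ) (V : ℝ) (n : ℕ)
    (hM1 : AEMeasurable (M1hat n) P) (hM2 : AEMeasurable (M2hat n) P)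
    (hσ : AEMeasurable (sigmaHat n) P) :
    AEMeasurable (studentFactor p χ F K h V Xs M1hat M2hat sigmaHat n) P :=
  ((((measurable_empF hs hp n _).div_const _).sqrt.const_mul _).aemeasurable.mul
    (((measurable_empBeta hs hp n).aemeasurable.mul (hM1.pow_const 2)).div
      (hM2.mul (hσ.pow_const 2))).sqrt).div (measurable_normalizedDen hs hp h2 F n).aemeasurable

variable [IsProbabilityMeasure P]

lemma tendstoInMeasure_studentFactor (hs : IsSample P X Y Xs Ys)
    (hp : Measurable fun x : E => p (χ - x)) (hX : Measurable X) (hpos : ∀ n, 1 ≤ n → 0 < h n)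
    (h2 : H2 K) (h3 : H3 (smallBall P p X χ) τ₀) (h4 : H4 (smallBall P p X χ) h 0 α β)
    (hF : ∀ t, 0 < t → 0 < smallBall P p X χ t) (hβ : 0 < β 1) (hsigma : 0 < sigmaSq χ)
    {V : ℝ} (hV : 0 < V) (hVeq : V = β 1 * (sigmaSq χ * M2 K τ₀))
    (hM1 : TendstoInMeasure P M1hat atTop (fun _ => M1 K τ₀))
    (hM2 : TendstoInMeasure P M2hat atTop (fun _ => M2 K τ₀))
    (hsigmaHat : TendstoInMeasure P sigmaHat atTop (fun _ => √(sigmaSq χ))) :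
    TendstoInMeasure P (studentFactor p χ (smallBall P p X χ) K h
      V Xs M1hat M2hat sigmaHat) atTop fun _ => 1 := by
  have hm1 := M1_pos hp hX h2 h3 hF
  have hm2 := M2_pos hp hX h2 h3 hF
  have hdenM : TendstoInMeasure P (normalizedDen p χ (smallBall P p X χ) K h Xs) atTop
      fun _ => β 1 * M1 K τ₀ :=
    tendstoInMeasure_denominator hs hp hX hpos h2 h3 h4 hF
  have hlim := tendstoInMeasure_student_of_tendsto V
    (tendstoInMeasure_empF_div hs hp hX h4.tendsto_nF)
    (tendstoInMeasure_empBeta hs hp hX h4) hM1 hM2 hsigmaHat hdenM hm2.ne'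
    (Real.sqrt_pos.2 hsigma).ne' (mul_pos hβ hm1).ne'
  have hone : √V * √1 * √(β 1 * M1 K τ₀ ^ 2 / (M2 K τ₀ * √(sigmaSq χ) ^ 2)) / (β 1 * M1 K τ₀) =
      1 := by
    rw [Real.sqrt_one, mul_one, ← Real.sqrt_mul hV.le, Real.sq_sqrt hsigma.le,
      div_eq_one_iff_eq (by positivity), hVeq,
      show β 1 * (sigmaSq χ * M2 K τ₀) * (β 1 * M1 K τ₀ ^ 2 / (M2 K τ₀ * sigmaSq χ)) =
        (β 1 * M1 K τ₀) ^ 2 by field_simp]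
    exact Real.sqrt_sq (by positivity)
  rw [hone] at hlim
  exact hlim

/-- Asymptotic normality of the studentized estimator. -/
theorem tendstoInDistribution_studentized
    (hmodel : IsRegressionModel P X Y r sigmaSq)
    (hsample : IsSample P X Y Xs Ys)
    (hp : Measurable fun x : E => p (χ - x)) (hpos : ∀ n, 1 ≤ n → 0 < h n)
    (h1 : H1 P p X r sigmaSq χ)
    (h2 : H2 K)
    (h3 : H3 (smallBall P p X χ) τ₀)
    (h4 : H4 (smallBall P p X χ) h 0 α β)
    (h5 : H5 P Y)
    (h7 : H7 (smallBall P p X χ) h)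
    (hsigma : 0 < sigmaSq χ)
    (hbias : Tendsto
      (fun n : ℕ => h n * √((n : ℝ) * smallBall P p X χ (h n)))
      atTop (𝓝 0))
    (hM1_meas : ∀ n, AEMeasurable (M1hat n) P)
    (hM2_meas : ∀ n, AEMeasurable (M2hat n) P)
    (hsigma_meas : ∀ n, AEMeasurable (sigmaHat n) P)
    (hM1 : TendstoInMeasure P M1hat atTop (fun _ => M1 K τ₀))
    (hM2 : TendstoInMeasure P M2hat atTop (fun _ => M2 K τ₀))
    (hsigmaHat : TendstoInMeasure P sigmaHat atTop (fun _ => √(sigmaSq χ))) :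
    TendstoInDistribution
      (studentized p χ (smallBall P p X χ) K h r
        Xs Ys M1hat M2hat sigmaHat)
      atTop (id : ℝ → ℝ) (fun _ => P) (gaussianReal 0 1) := by
  have hX := hmodel.measurable_X
  have hF : ∀ t, 0 < t → 0 < smallBall P p X χ t := fun t ht =>
    smallBall_pos h4.tendsto_h h4.tendsto_nF ht
  have hβ : 0 < β 1 := h4.beta_one_pos fun n hn => hF _ (hpos n hn)
  have hm1 := M1_pos hp hX h2 h3 hF
  have hm2 := M2_pos hp hX h2 h3 hF
  have hV0 : 0 < β 1 * (sigmaSq χ * M2 K τ₀) := by positivity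
  have hdenM : TendstoInMeasure P (normalizedDen p χ (smallBall P p X χ) K h Xs) atTop
      fun _ => β 1 * M1 K τ₀ :=
    tendstoInMeasure_denominator hsample hp hX hpos h2 h3 h4 hF
  have hnum : TendstoInDistribution (normalizedNum p χ (smallBall P p X χ) K h r
      (β 1 * (sigmaSq χ * M2 K τ₀)) Xs Ys) atTop (id : ℝ → ℝ) (fun _ => P) (gaussianReal 0 1) :=
    tendstoInDistribution_numerator hmodel hsample hp hpos h1 h2 h3 h4 h5 h7 hF hbias hV0 rfl
  have hprod := hnum.continuous_comp_prodMk_of_tendstoInMeasure_const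
    (g := fun q : ℝ × ℝ => q.1 * q.2) (by fun_prop)
    (tendstoInMeasure_studentFactor hsample hp hX hpos h2 h3 h4 hF hβ hsigma hV0 rfl
      hM1 hM2 hsigmaHat)
    fun n => aemeasurable_studentFactor hsample hp h2 _ _ n (hM1_meas n) (hM2_meas n)
      (hsigma_meas n)
  have hlim := hprod.congr (fun n => EventuallyEq.rfl)
    (ae_of_all (gaussianReal 0 1) fun x => mul_one (id x))
  -- the two agree unless all kernel weights vanish, where the estimator has its default value
  refine tendstoInDistribution_of_tendstoInMeasure_sub _ _ hlim ?_ fun n =>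
    aemeasurable_studentized hsample hp h2 _ n (hM1_meas n) (hM2_meas n) (hsigma_meas n)
  rw [tendstoInMeasure_iff_dist] at hdenM ⊢
  intro ε hε
  refine tendsto_of_tendsto_of_tendsto_of_le_of_le' tendsto_const_nhds
    (hdenM (β 1 * M1 K τ₀) (by positivity)) (Eventually.of_forall fun _ => zero_le) ?_
  filter_upwards [h4.tendsto_nF.eventually_gt_atTop 0] with n hn
  refine measure_mono fun ω hω => ?_
  rw [Set.mem_ofPred_eq] at hω ⊢
  by_contra hlt
  have hne : normalizedDen p χ (smallBall P p X χ) K h Xs n ω ≠ 0 := by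
    intro h0
    rw [h0, Real.dist_eq, zero_sub, abs_neg, abs_of_pos (by positivity)] at hlt
    exact hlt le_rfl
  have heq := studentized_eq_mul p χ (smallBall P p X χ) K h r hV0 Xs Ys M1hat M2hat sigmaHat hn hne
  refine absurd hω (not_le.2 (lt_of_eq_of_lt ?_ hε))
  rw [Pi.sub_apply, Pi.sub_apply, heq]
  simp [normalizedNum]

end Studentization

end FunctionalRegression

theorem corollary2
    {Ω E : Type*} [MeasurableSpace Ω] [NormedAddCommGroup E] [NormedSpace ℝ E] [CompleteSpace E]
    [MeasurableSpace E]
    (P : Measure Ω) [IsProbabilityMeasure P]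
    (p : Seminorm ℝ E) (χ : E) (hp : Measurable fun x : E => p (χ - x))
    (X : Ω → E) (Y : Ω → ℝ) (r sigmaSq : E → ℝ)
    (hmodel : FunctionalRegression.IsRegressionModel P X Y r sigmaSq)
    (Xs : ℕ → Ω → E) (Ys : ℕ → Ω → ℝ)
    (hsample : FunctionalRegression.IsSample P X Y Xs Ys)
    (K τ₀ : ℝ → ℝ) (h : ℕ → ℝ) (hpos : ∀ n, 1 ≤ n → 0 < h n) (α : ℝ) (β : ℝ → ℝ)
    (h1 : FunctionalRegression.H1 P p X r sigmaSq χ)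
    (h2 : FunctionalRegression.H2 K)
    (h3 : FunctionalRegression.H3 (FunctionalRegression.smallBall P p X χ) τ₀)
    (h4 : FunctionalRegression.H4 (FunctionalRegression.smallBall P p X χ) h 0 α β)
    (h5 : FunctionalRegression.H5 P Y)
    (h7 : FunctionalRegression.H7 (FunctionalRegression.smallBall P p X χ) h)
    (hsigma : 0 < sigmaSq χ)
    (hbias : Tendsto
      (fun n : ℕ => h n * √((n : ℝ) * FunctionalRegression.smallBall P p X χ (h n)))
      atTop (𝓝 0))
    (hlog : Tendsto
      (fun n : ℕ => Real.log n / ((n : ℝ) * FunctionalRegression.smallBall P p X χ (h n) ^ 2))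
      atTop (𝓝 0))
    (M1hat M2hat sigmaHat : ℕ → Ω → ℝ)
    (hM1_meas : ∀ n, AEMeasurable (M1hat n) P)
    (hM2_meas : ∀ n, AEMeasurable (M2hat n) P)
    (hsigma_meas : ∀ n, AEMeasurable (sigmaHat n) P)
    (hM1 : TendstoInMeasure P M1hat atTop (fun _ => FunctionalRegression.M1 K τ₀))
    (hM2 : TendstoInMeasure P M2hat atTop (fun _ => FunctionalRegression.M2 K τ₀))
    (hsigmaHat : TendstoInMeasure P sigmaHat atTop (fun _ => √(sigmaSq χ))) :
    TendstoInDistribution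
      (FunctionalRegression.studentized p χ (FunctionalRegression.smallBall P p X χ) K h r
        Xs Ys M1hat M2hat sigmaHat)
      atTop (id : ℝ → ℝ) (fun _ => P) (gaussianReal 0 1) := by
  exact FunctionalRegression.tendstoInDistribution_studentized hmodel hsample hp hpos h1 h2 h3 h4
    h5 h7 hsigma hbias hM1_meas hM2_meas hsigma_meas hM1 hM2 hsigmaHat
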